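/- Let $S^1=\mathbb R/2\pi\mathbb Z$, let $C^\infty(S^1,\mathbb R^d)$ carry its Fréchet topology, and let $\mathrm{Imm}(S^1,\mathbb R^d)$ be the space of $c\in C^\infty(S^1,\mathbb R^d)$ with $c'\ne 0$ everywhere, so that $T_c\mathrm{Imm}=C^\infty(S^1,\mathbb R^d)$. For $c\in\mathrm{Imm}(S^1,\mathbb R^d)$ write $ds=|c'|\,d\theta$, $D_s=|c'|^{-1}\partial_\theta$, $v=D_sc$, $\ell_c=\int_{S^1}ds$, and $\psi_c(\theta)=\frac{2\pi}{\ell_c}\int_0^\theta|c'|\,d\sigma$ for $\theta\in[0,2\pi]$; $\psi_c$ induces a diffeomorphism of $S^1$. Write $R_\varphi h=h\circ\varphi$. Let $A(\lambda)$, $\lambda>0$, be continuous linear operators on $C^\infty(S^1,\mathbb R^d)$ such that $(\lambda,h)\mapsto A(\lambda)h$ is smooth, with derivative $A'(\lambda)$ in $\lambda$. Put $$A_c=R_{\psi_c}\circ A(\ell_c)\circ R_{\psi_c}^{-1},\qquad A_c'=R_{\psi_c}\circ A'(\ell_c)\circ R_{\psi_c}^{-1},\qquad G_c(h,k)=\int_{S^1}\langle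 A_ch,k\rangle\,ds .$$ Assume that $G$ is a weak Riemannian metric on $\mathrm{Imm}(S^1,\mathbb R^d)$ (each $G_c$ is symmetric and positive definite) which is invariant under orientation-preserving diffeomorphisms, i.e. $G_{c\circ\varphi}(h\circ\varphi,k\circ\varphi)=G_c(h,k)$ for all $\varphi\in\mathrm{Diff}^+(S^1)$, and that each $A(\lambda)$ is invertible on $C^\infty(S^1,\mathbb R^d)$ with continuous inverse. Then every $A_c$ is bijective, for each $k$ the map $c\mapsto A_ck$ has directional derivatives $(D_{c,h}A_c)k\in C^\infty(S^1,\mathbb R^d)$, and $G$ has the geodesic spray $F(c,h)=(h,S_c(h))$, where $$S_c(h)=-A_c^{-1}\bigl\{(D_{c,h}A_c)h+\langle D_sh,v\rangle A_ch+\langle A_ch,D_sh\rangle v+(w+w_0)D_sv\bigr\},$$ $$w(c,h)(\theta)=\int_0^\theta\langle A_ch,D_sh\rangle\,ds,\qquad w_0(c,h)=\int_{S^1}\Bigl(\tfrac1{2\pi}\langle A_ch,\psi_cD_sh\rangle+\tfrac12\langle(\ell_c^{-1}A_c+A_c')h,h\rangle\Bigr)ds .$$ That is, $S_c(rh)=r^2S_c(h)$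 for $r\in\mathbb R$, and $G_c(S_c(h),k)=\tfrac12D_{c,k}\bigl(G_c(h,h)\bigr)-D_{c,h}\bigl(G_c(h,k)\bigr)$ for all $c,h,k$, these directional derivatives existing ($h$ and $k$ being held fixed). Moreover, for a smooth path $c:[0,1]\to\mathrm{Imm}(S^1,\mathbb R^d)$ the following are equivalent: (i) $c$ is a geodesic, i.e. a critical point of $E(c)=\frac12\int_0^1G_c(c_t,c_t)\,dt$ under smooth variations with fixed endpoints; (ii) $c_{tt}=S_c(c_t)$ on $[0,1]$; (iii) the geodesic equation $$(A_cc_t)_t=-\langle D_sc_t,v\rangle A_cc_t-\langle A_cc_t,D_sc_t\rangle v-\bigl(w(c,c_t)+w_0(c,c_t)\bigr)D_sv$$ holds on $[0,1]$. -/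

import Mathlib

open scoped ContDiff Topology

noncomputable section

namespace ImmersedCurves

/-- Euclidean space `ℝᵈ`. -/
abbrev Vec (d : ℕ) : Type := EuclideanSpace ℝ (Fin d)

/-! ### The Fréchet space of smooth loops -/

/-- The linear space of smooth `2π`-periodic functions `ℝ → ℝᵈ`. -/
def smoothPeriodic (d : ℕ) : Submodule ℝ (ℝ → Vec d) where
  carrier := {f | ContDiff ℝ ∞ f ∧ ∀ θ, f (θ + 2 * Real.pi) = f θ}
  add_mem' := fun hf hg =>
    ⟨hf.1.add hg.1, fun θ => by simp only [Pi.add_apply, hf.2 θ, hg.2 θ]⟩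
  zero_mem' := ⟨contDiff_const, fun _ => rfl⟩
  smul_mem' := fun r f hf =>
    ⟨contDiff_const.smul hf.1, fun θ => by simp only [Pi.smul_apply, hf.2 θ]⟩

/-- `C^∞(S¹, ℝᵈ)`, where `S¹ = ℝ / 2πℤ`. It is a type of its own, since its topology is not
the topology of pointwise convergence. -/
def Loop (d : ℕ) : Type := smoothPeriodic d

instance (d : ℕ) : AddCommGroup (Loop d) := inferInstanceAs (AddCommGroup (smoothPeriodic d))
instance (d : ℕ) : Module ℝ (Loop d) := inferInstanceAs (Module ℝ (smoothPeriodic d))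

/-- The loop given by a smooth periodic function. -/
def Loop.mk {d : ℕ} (f : ℝ → Vec d) (hf : ContDiff ℝ ∞ f)
    (hp : ∀ θ, f (θ + 2 * Real.pi) = f θ) : Loop d :=
  (⟨f, hf, hp⟩ : smoothPeriodic d)

/-- The underlying periodic function of a loop. -/
def Loop.toFun {d : ℕ} (h : Loop d) : ℝ → Vec d := Subtype.val (p := (· ∈ smoothPeriodic d)) h

instance (d : ℕ) : CoeFun (Loop d) (fun _ => ℝ → Vec d) := ⟨Loop.toFun⟩

theorem Loop.ext {d : ℕ} {h k : Loop d} (H : ∀ θ, h θ = k θ) : h = k := Subtype.ext (funext H)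

theorem Loop.mk_apply {d : ℕ} (f : ℝ → Vec d) (hf : ContDiff ℝ ∞ f)
    (hp : ∀ θ, f (θ + 2 * Real.pi) = f θ) (θ : ℝ) : Loop.mk f hf hp θ = f θ := rfl

theorem Loop.add_apply {d : ℕ} (h k : Loop d) (θ : ℝ) : (h + k) θ = h θ + k θ := rfl

theorem Loop.smul_apply {d : ℕ} (r : ℝ) (h : Loop d) (θ : ℝ) : (r • h) θ = r • h θ := rfl

theorem Loop.contDiff {d : ℕ} (h : Loop d) : ContDiff ℝ ∞ h.toFun :=
  (Subtype.property (p := (· ∈ smoothPeriodic d)) h).1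

theorem Loop.periodic {d : ℕ} (h : Loop d) (θ : ℝ) : h (θ + 2 * Real.pi) = h θ :=
  (Subtype.property (p := (· ∈ smoothPeriodic d)) h).2 θ

/-- All derivatives of a smooth loop, as continuous functions. -/
def Loop.jets (d : ℕ) : Loop d →ₗ[ℝ] (ℕ → C(ℝ, Vec d)) where
  toFun h k := ⟨iteratedDeriv k h, h.contDiff.continuous_iteratedDeriv k (by exact_mod_cast le_top)⟩
  map_add' h g := by
    ext1 k
    apply ContinuousMap.ext
    intro θ
    exact iteratedDeriv_add
      (h.contDiff.of_le (by exact_mod_cast le_top)).contDiffAt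
      (g.contDiff.of_le (by exact_mod_cast le_top)).contDiffAt
  map_smul' r h := by
    ext1 k
    apply ContinuousMap.ext
    intro θ
    exact iteratedDeriv_const_smul
      (h.contDiff.of_le (by exact_mod_cast le_top)).contDiffAt r

/-- The Fréchet topology: uniform convergence of all derivatives. (Locally uniform convergence
on `ℝ`, which the topology of `C(ℝ, ℝᵈ)` describes, is uniform convergence for periodic
functions.) -/
instance (d : ℕ) : TopologicalSpace (Loop d) := TopologicalSpace.induced (Loop.jets d) inferInstance

instance (d : ℕ) : IsTopologicalAddGroup (Loop d) := topologicalAddGroup_induced (Loop.jets d)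

instance (d : ℕ) : ContinuousSMul ℝ (Loop d) := continuousSMul_induced (Loop.jets d)

/-! ### Smooth families and curves in the space of smooth loops -/

/-- A family of smooth loops with parameters in `P` is smooth if it is smooth jointly in the
parameter and in the variable of the loop. -/
def IsSmoothFamily {d : ℕ} {P : Type} [NormedAddCommGroup P] [NormedSpace ℝ P]
    (γ : P → Loop d) : Prop :=
  ContDiff ℝ ∞ (fun p : P × ℝ => γ p.1 p.2)

/-- The derivative `∂_t γ` of a smooth curve of loops, at the time `t`. -/
def velocity {d : ℕ} (γ : ℝ → Loop d) (hγ : IsSmoothFamily γ) (t : ℝ) : Loop d :=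
  Loop.mk (fun θ => deriv (fun τ => γ τ θ) t)
    (by
      have h : (fun θ => deriv (fun τ => γ τ θ) t)
          = fun θ => fderiv ℝ (fun p : ℝ × ℝ => γ p.1 p.2) (t, θ) (1, 0) := by
        funext θ
        have h1 : HasFDerivAt (fun p : ℝ × ℝ => γ p.1 p.2)
            (fderiv ℝ (fun p : ℝ × ℝ => γ p.1 p.2) (t, θ)) (t, θ) :=
          (hγ.differentiable (by simp) (t, θ)).hasFDerivAt
        have h2 : HasDerivAt (fun τ : ℝ => (τ, θ)) ((1 : ℝ), (0 : ℝ)) t :=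
          (hasDerivAt_id t).prodMk (hasDerivAt_const t θ)
        exact (h1.comp_hasDerivAt t h2).deriv
      rw [h]
      have h3 : ContDiff ℝ ∞ (fderiv ℝ (fun p : ℝ × ℝ => γ p.1 p.2)) :=
        hγ.fderiv_right (by simp)
      exact (h3.comp (contDiff_const.prodMk contDiff_id)).clm_apply contDiff_const)
    (fun θ => by simp only [Loop.periodic])

theorem isSmoothFamily_velocity {d : ℕ} (γ : ℝ → Loop d) (hγ : IsSmoothFamily γ) :
    IsSmoothFamily (velocity γ hγ) := by
  have h : (fun p : ℝ × ℝ => velocity γ hγ p.1 p.2)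
      = fun p => fderiv ℝ (fun p : ℝ × ℝ => γ p.1 p.2) p (1, 0) := by
    funext p
    have h1 : HasFDerivAt (fun p : ℝ × ℝ => γ p.1 p.2)
        (fderiv ℝ (fun p : ℝ × ℝ => γ p.1 p.2) (p.1, p.2)) (p.1, p.2) :=
      (hγ.differentiable (by simp) (p.1, p.2)).hasFDerivAt
    have h2 : HasDerivAt (fun τ : ℝ => (τ, p.2)) ((1 : ℝ), (0 : ℝ)) p.1 :=
      (hasDerivAt_id p.1).prodMk (hasDerivAt_const p.1 p.2)
    exact (h1.comp_hasDerivAt p.1 h2).deriv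
  unfold IsSmoothFamily
  rw [h]
  have h3 : ContDiff ℝ ∞ (fderiv ℝ (fun p : ℝ × ℝ => γ p.1 p.2)) :=
    hγ.fderiv_right (by simp)
  exact h3.clm_apply contDiff_const

/-- A smooth two-parameter family restricts to smooth curves. -/
theorem IsSmoothFamily.slice {d : ℕ} {f : ℝ → ℝ → Loop d}
    (hf : IsSmoothFamily (fun p : ℝ × ℝ => f p.1 p.2)) (ε : ℝ) : IsSmoothFamily (f ε) :=
  ContDiff.comp (g := fun p : (ℝ × ℝ) × ℝ => f p.1.1 p.1.2 p.2)
    (f := fun p : ℝ × ℝ => ((ε, p.1), p.2)) hf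
    ((contDiff_const.prodMk contDiff_fst).prodMk contDiff_snd)

/-- The family of operators `A(λ)`, `λ > 0`, is smooth: the map `(λ, h) ↦ A(λ) h` on
`(0, ∞) × C^∞(S¹, ℝᵈ)` is smooth, i.e. it takes smooth finite-dimensional families of arguments
to smooth families of loops. -/
def IsSmoothOperatorFamily {d : ℕ} (A : ℝ → Loop d →L[ℝ] Loop d) : Prop :=
  ∀ (P : Type) [NormedAddCommGroup P] [NormedSpace ℝ P] [FiniteDimensional ℝ P]
    (l : P → ℝ) (h : P → Loop d),
    ContDiff ℝ ∞ l → (∀ p, 0 < l p) → IsSmoothFamily h → IsSmoothFamily (fun p => A (l p) (h p))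

/-! ### Immersions and diffeomorphisms -/

/-- `Imm(S¹, ℝᵈ)`: the smooth loops `c` with `c' ≠ 0` everywhere. The tangent space at each of its
points is `Loop d`. -/
structure Imm (d : ℕ) where
  /-- The underlying loop. -/
  loop : Loop d
  deriv_ne_zero : ∀ θ, deriv loop θ ≠ 0

/-- Orientation preserving diffeomorphisms of `S¹ = ℝ / 2πℤ`, given by a lift to `ℝ`. -/
structure CircleDiff where
  toFun : ℝ → ℝ
  smooth : ContDiff ℝ ∞ toFun
  deriv_pos : ∀ θ, 0 < deriv toFun θ
  add_period : ∀ θ, toFun (θ + 2 * Real.pi) = toFun θ + 2 * Real.pi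

instance : CoeFun CircleDiff (fun _ => ℝ → ℝ) := ⟨CircleDiff.toFun⟩

theorem CircleDiff.strictMono (φ : CircleDiff) : StrictMono φ := strictMono_of_deriv_pos φ.deriv_pos

theorem CircleDiff.add_nat (φ : CircleDiff) (n : ℕ) (θ : ℝ) :
    φ (θ + n * (2 * Real.pi)) = φ θ + n * (2 * Real.pi) := by
  induction n with
  | zero => simp
  | succ n ih =>
    have h : θ + ((n + 1 : ℕ) : ℝ) * (2 * Real.pi)
        = (θ + n * (2 * Real.pi)) + 2 * Real.pi := by push_cast; ring
    rw [h, φ.add_period, ih]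
    push_cast
    ring

theorem CircleDiff.surjective (φ : CircleDiff) : Function.Surjective φ := by
  intro y
  have hpi : (0 : ℝ) < 2 * Real.pi := by positivity
  obtain ⟨n, hn⟩ := exists_nat_ge (|y - φ 0| / (2 * Real.pi))
  have hn' : |y - φ 0| ≤ n * (2 * Real.pi) := (div_le_iff₀ hpi).1 hn
  have hup : φ (0 + n * (2 * Real.pi)) = φ 0 + n * (2 * Real.pi) := φ.add_nat n 0
  have hlow := φ.add_nat n (-(n * (2 * Real.pi)))
  rw [neg_add_cancel] at hlow
  obtain ⟨h1, h2⟩ := abs_le.1 hn'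
  have hle : -((n : ℝ) * (2 * Real.pi)) ≤ 0 + n * (2 * Real.pi) := by
    have : (0 : ℝ) ≤ n * (2 * Real.pi) := by positivity
    linarith
  obtain ⟨x, _, hx⟩ := intermediate_value_Icc hle φ.smooth.continuous.continuousOn
    (show y ∈ Set.Icc _ _ from ⟨by linarith, by linarith⟩)
  exact ⟨x, hx⟩

/-- A lift of a diffeomorphism of the circle, as a homeomorphism of `ℝ`. -/
def CircleDiff.homeomorph (φ : CircleDiff) : ℝ ≃ₜ ℝ :=
  (φ.strictMono.orderIsoOfSurjective φ φ.surjective).toHomeomorph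

/-- The inverse diffeomorphism. -/
def CircleDiff.symm (φ : CircleDiff) : CircleDiff where
  toFun := φ.homeomorph.symm
  smooth := φ.homeomorph.contDiff_symm_deriv (f' := deriv φ) (fun x => (φ.deriv_pos x).ne')
    (fun x => (φ.smooth.differentiable (by simp) x).hasDerivAt) φ.smooth
  deriv_pos := fun y => by
    have h1 : HasDerivAt φ (deriv φ (φ.homeomorph.symm y)) (φ.homeomorph.symm y) :=
      (φ.smooth.differentiable (by simp) _).hasDerivAt
    have h2 : HasDerivAt φ.homeomorph.symm (deriv φ (φ.homeomorph.symm y))⁻¹ y :=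
      h1.of_local_left_inverse φ.homeomorph.symm.continuous.continuousAt (φ.deriv_pos _).ne'
        (Filter.Eventually.of_forall fun z => φ.homeomorph.apply_symm_apply z)
    rw [h2.deriv]
    exact inv_pos.2 (φ.deriv_pos _)
  add_period := fun y => by
    rw [Homeomorph.symm_apply_eq]
    have h1 : φ.homeomorph (φ.homeomorph.symm y) = y := φ.homeomorph.apply_symm_apply y
    exact (congrArg (· + 2 * Real.pi) h1).symm.trans (φ.add_period (φ.homeomorph.symm y)).symm

theorem CircleDiff.apply_symm_apply (φ : CircleDiff) (θ : ℝ) : φ (φ.symm θ) = θ :=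
  φ.homeomorph.apply_symm_apply θ

theorem CircleDiff.symm_apply_apply (φ : CircleDiff) (θ : ℝ) : φ.symm (φ θ) = θ :=
  φ.homeomorph.symm_apply_apply θ

/-- The reparametrization `R_φ h = h ∘ φ`. -/
def reparam {d : ℕ} (φ : CircleDiff) : Loop d →ₗ[ℝ] Loop d where
  toFun h := Loop.mk (fun θ => h (φ θ)) (h.contDiff.comp φ.smooth) fun θ => by
    simp only [φ.add_period, h.periodic]
  map_add' _ _ := rfl
  map_smul' _ _ := rfl

/-- The action `(c, φ) ↦ c ∘ φ` on immersions. -/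
def Imm.reparam {d : ℕ} (c : Imm d) (φ : CircleDiff) : Imm d :=
  ⟨ImmersedCurves.reparam φ c.loop, fun θ => by
    have h : HasDerivAt (ImmersedCurves.reparam φ c.loop) (deriv φ θ • deriv c.loop (φ θ)) θ :=
      HasDerivAt.scomp (h := φ) θ
        (c.loop.contDiff.differentiable (by simp) (φ θ)).hasDerivAt
        (φ.smooth.differentiable (by simp) θ).hasDerivAt
    rw [h.deriv]
    exact smul_ne_zero (φ.deriv_pos θ).ne' (c.deriv_ne_zero (φ θ))⟩

/-! ### Arc length calculus -/

/-- The speed `|c'|`. -/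
def speed {d : ℕ} (c : Imm d) (θ : ℝ) : ℝ := ‖deriv c.loop θ‖

/-- The derivative `D_s f = f' / |c'|` with respect to arc length. -/
def arcDeriv {d : ℕ} (c : Imm d) (f : ℝ → Vec d) (θ : ℝ) : Vec d := (speed c θ)⁻¹ • deriv f θ

/-- The unit tangent vector `v = D_s c`. -/
def tangent {d : ℕ} (c : Imm d) : ℝ → Vec d := arcDeriv c c.loop

/-- The integral `∫_{S¹} f ds` with respect to arc length. -/
def arcIntegral {d : ℕ} (c : Imm d) (f : ℝ → ℝ) : ℝ :=
  ∫ θ in (0 : ℝ)..(2 * Real.pi), f θ * speed c θ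

/-- The length `ℓ_c = ∫_{S¹} ds`. -/
def len {d : ℕ} (c : Imm d) : ℝ := ∫ θ in (0 : ℝ)..(2 * Real.pi), speed c θ

theorem speed_pos {d : ℕ} (c : Imm d) (θ : ℝ) : 0 < speed c θ := norm_pos_iff.2 (c.deriv_ne_zero θ)

theorem contDiff_speed {d : ℕ} (c : Imm d) : ContDiff ℝ ∞ (speed c) :=
  ContDiff.norm ℝ ((contDiff_infty_iff_deriv.1 c.loop.contDiff).2) c.deriv_ne_zero

theorem speed_periodic {d : ℕ} (c : Imm d) : Function.Periodic (speed c) (2 * Real.pi) := by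
  intro θ
  unfold speed
  rw [← deriv_comp_add_const]
  simp only [Loop.periodic]

theorem len_pos {d : ℕ} (c : Imm d) : 0 < len c :=
  intervalIntegral.intervalIntegral_pos_of_pos
    ((contDiff_speed c).continuous.intervalIntegrable _ _) (speed_pos c) (by positivity)

theorem hasDerivAt_psi {d : ℕ} (c : Imm d) (θ : ℝ) :
    HasDerivAt (fun θ => 2 * Real.pi / len c * ∫ σ in (0 : ℝ)..θ, speed c σ)
      (2 * Real.pi / len c * speed c θ) θ :=
  ((contDiff_speed c).continuous.integral_hasStrictDerivAt 0 θ).hasDerivAt.const_mul _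

/-- The diffeomorphism `ψ_c(θ) = (2π / ℓ_c) ∫_0^θ |c'| dσ`; the curve `c ∘ ψ_c⁻¹` has constant
speed. -/
def psi {d : ℕ} (c : Imm d) : CircleDiff where
  toFun θ := 2 * Real.pi / len c * ∫ σ in (0 : ℝ)..θ, speed c σ
  smooth := by
    rw [contDiff_infty_iff_deriv]
    refine ⟨fun θ => (hasDerivAt_psi c θ).differentiableAt, ?_⟩
    rw [show deriv (fun θ => 2 * Real.pi / len c * ∫ σ in (0 : ℝ)..θ, speed c σ)
      = fun θ => 2 * Real.pi / len c * speed c θ from funext fun θ => (hasDerivAt_psi c θ).deriv]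
    exact contDiff_const.mul (contDiff_speed c)
  deriv_pos θ := by
    rw [(hasDerivAt_psi c θ).deriv]
    have := len_pos c
    have := speed_pos c θ
    positivity
  add_period θ := by
    have hc := (contDiff_speed c).continuous
    have h1 : (∫ σ in θ..(θ + 2 * Real.pi), speed c σ) = len c := by
      rw [(speed_periodic c).intervalIntegral_add_eq θ 0, zero_add]
      rfl
    rw [← intervalIntegral.integral_add_adjacent_intervals (hc.intervalIntegrable 0 θ)
      (hc.intervalIntegrable θ (θ + 2 * Real.pi)), h1, mul_add,
      div_mul_cancel₀ _ (len_pos c).ne']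

/-! ### The metric -/

/-- The operator `A_c = R_{ψ_c} ∘ A(ℓ_c) ∘ R_{ψ_c}⁻¹`. -/
def opA {d : ℕ} (A : ℝ → Loop d →L[ℝ] Loop d) (c : Imm d) : Loop d →ₗ[ℝ] Loop d :=
  reparam (psi c) ∘ₗ (A (len c) : Loop d →ₗ[ℝ] Loop d) ∘ₗ reparam (psi c).symm

/-- The loop `A_c' h`, where `A_c' = R_{ψ_c} ∘ A'(ℓ_c) ∘ R_{ψ_c}⁻¹` and `A'` is the derivative
of `λ ↦ A(λ)`. -/
def opA' {d : ℕ} (A : ℝ → Loop d →L[ℝ] Loop d) (c : Imm d) (h : Loop d) (θ : ℝ) : Vec d :=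
  deriv (fun l : ℝ => A l (reparam (psi c).symm h) (psi c θ)) (len c)

/-- `G_c(h, k) = ∫_{S¹} ⟨A_c h, k⟩ ds`. -/
def metric {d : ℕ} (A : ℝ → Loop d →L[ℝ] Loop d) (c : Imm d) (h k : Loop d) : ℝ :=
  arcIntegral c (fun θ => inner ℝ (opA A c h θ) (k θ))

/-- Each `G_c` is an inner product on the tangent space `C^∞(S¹, ℝᵈ)` at `c`. (For the metric
`G = metric A`, bilinearity is clear, and smoothness follows from the smoothness of `A`.) -/
structure IsWeakRiemannianMetric {d : ℕ} (G : Imm d → Loop d → Loop d → ℝ) : Prop where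
  symm : ∀ c h k, G c h k = G c k h
  pos : ∀ c h, h ≠ 0 → 0 < G c h h

/-- Invariance under (orientation preserving) reparametrizations. -/
def IsReparamInvariant {d : ℕ} (G : Imm d → Loop d → Loop d → ℝ) : Prop :=
  ∀ (φ : CircleDiff) (c : Imm d) (h k : Loop d),
    G (c.reparam φ) (reparam φ h) (reparam φ k) = G c h k

/-! ### Sprays and geodesics -/

/-- The map `Φ` on immersions, with values in a topological vector space, has at `c` the
derivative `D_{c,h} Φ = v` in the direction `h`: it has the derivative `v` along every smooth
curve of immersions that passes through `c` with velocity `h`. -/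
def HasDirDeriv {d : ℕ} {V : Type} [AddCommGroup V] [Module ℝ V] [TopologicalSpace V]
    (Φ : Imm d → V) (c : Imm d) (h : Loop d) (v : V) : Prop :=
  ∀ (γ : ℝ → Imm d) (hγ : IsSmoothFamily (fun ε => (γ ε).loop)),
    γ 0 = c → velocity (fun ε => (γ ε).loop) hγ 0 = h →
      Filter.Tendsto (fun ε : ℝ => ε⁻¹ • (Φ (γ ε) - Φ c)) (𝓝[≠] 0) (𝓝 v)

/-- `F` is the geodesic spray of `G`: a second order vector field `F(c, h) = (h, S_c(h))` on the
tangent bundle `Imm × C^∞(S¹, ℝᵈ)`, homogeneous of degree two in `h`, with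
`G_c(S_c(h), k) = ½ D_{c,k}(G(h, h)) - D_{c,h}(G(h, k))`. -/
structure IsGeodesicSpray {d : ℕ} (G : Imm d → Loop d → Loop d → ℝ)
    (F : Imm d × Loop d → Loop d × Loop d) : Prop where
  second_order : ∀ c h, (F (c, h)).1 = h
  homogeneous : ∀ (c : Imm d) (h : Loop d) (r : ℝ), (F (c, r • h)).2 = r ^ 2 • (F (c, h)).2
  metric_eq : ∀ c h k, ∃ a b : ℝ,
    HasDirDeriv (fun c' => G c' h h) c k a ∧ HasDirDeriv (fun c' => G c' h k) c h b ∧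
      G c (F (c, h)).2 k = 1 / 2 * a - b

/-- The velocity `c_t` of a smooth path of immersions. -/
def pathVelocity {d : ℕ} (c : ℝ → Imm d) (hc : IsSmoothFamily (fun t => (c t).loop)) (t : ℝ) :
    Loop d :=
  velocity (fun t => (c t).loop) hc t

/-- The acceleration `c_tt` of a smooth path of immersions. -/
def pathAcceleration {d : ℕ} (c : ℝ → Imm d) (hc : IsSmoothFamily (fun t => (c t).loop))
    (t : ℝ) : Loop d :=
  velocity (pathVelocity c hc) (isSmoothFamily_velocity _ hc) t

/-- The energy `E(c) = ½ ∫_0^1 G_c(c_t, c_t) dt` of (the restriction to `[0, 1]` of) a smooth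
path of immersions. -/
def energy {d : ℕ} (G : Imm d → Loop d → Loop d → ℝ) (c : ℝ → Imm d)
    (hc : IsSmoothFamily (fun t => (c t).loop)) : ℝ :=
  1 / 2 * ∫ t in (0 : ℝ)..1, G (c t) (pathVelocity c hc t) (pathVelocity c hc t)

/-- The restriction of the smooth path `c` to `[0, 1]` is a geodesic: a critical point of the
energy on paths with fixed endpoints. -/
def IsGeodesic {d : ℕ} (G : Imm d → Loop d → Loop d → ℝ) (c : ℝ → Imm d) : Prop :=
  ∀ (f : ℝ → ℝ → Imm d) (hf : IsSmoothFamily (fun p : ℝ × ℝ => (f p.1 p.2).loop)),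
    (∀ t ∈ Set.Icc (0 : ℝ) 1, f 0 t = c t) →
    (∀ ε, f ε 0 = c 0) → (∀ ε, f ε 1 = c 1) →
      HasDerivAt (fun ε => energy G (f ε)
        (IsSmoothFamily.slice (f := fun ε t => (f ε t).loop) hf ε)) 0 0

/-! ### The terms of the geodesic equation -/

/-- `w(c, h)(θ) = ∫_0^θ ⟨A_c h, D_s h⟩ ds`. -/
def wTerm {d : ℕ} (A : ℝ → Loop d →L[ℝ] Loop d) (c : Imm d) (h : Loop d) (θ : ℝ) : ℝ :=
  ∫ σ in (0 : ℝ)..θ, inner ℝ (opA A c h σ) (arcDeriv c h σ) * speed c σ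

/-- `w₀(c, h) = ∫_{S¹} (1/2π) ⟨A_c h, ψ_c D_s h⟩ + ½ ⟨(ℓ_c⁻¹ A_c + A_c') h, h⟩ ds`. -/
def wZero {d : ℕ} (A : ℝ → Loop d →L[ℝ] Loop d) (c : Imm d) (h : Loop d) : ℝ :=
  arcIntegral c (fun θ =>
    1 / (2 * Real.pi) * inner ℝ (opA A c h θ) (psi c θ • arcDeriv c h θ)
      + 1 / 2 * inner ℝ ((len c)⁻¹ • opA A c h θ + opA' A c h θ) (h θ))

/-- `⟨D_s h, v⟩ A_c h + ⟨A_c h, D_s h⟩ v + (w(c, h) + w₀(c, h)) D_s v`. -/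
def geodesicTerm {d : ℕ} (A : ℝ → Loop d →L[ℝ] Loop d) (c : Imm d) (h : Loop d) (θ : ℝ) : Vec d :=
  inner ℝ (arcDeriv c h θ) (tangent c θ) • opA A c h θ
    + inner ℝ (opA A c h θ) (arcDeriv c h θ) • tangent c θ
    + (wTerm A c h θ + wZero A c h) • arcDeriv c (tangent c) θ

end ImmersedCurves

end

open ImmersedCurves

noncomputable section

namespace ImmersedCurves

/-! ### Integrals depending smoothly on parameters -/

/-! The difficulty is to write `½ D_{c,m} G_c(h, h)` as an `L²(ds)` pairing of a loop with `m`. In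
the variable `y = ψ_c(θ)`, with `h̃ = h ∘ ψ_c⁻¹`, the metric reads `G_c(h, h) = (ℓ_c / 2π) ∫ ⟨A(ℓ_c)
h̃, h̃⟩ dy` (`metric_eq_integral`), so `c` enters only through `ℓ_c` and `h̃`. Differentiating along
a curve with velocity `m`, the symmetry of `G_c` merges the two terms with `∂_t h̃`, and `∂_t h̃`,
pulled back by `ψ_c`, is `-(ℓ_c / 2π) ψ̇ D_s h`. Since `ψ̇` is built from primitives of `⟨D_s m, v⟩
|c'|`, one integration by parts gives `D_{c,m} G_c(h, h) = 2 ∫ (w + w₀) ⟨D_s m, v⟩ ds`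
(`metricDeriv_self`), and a second one moves the derivative off `m` (`integral_wTerm_mul_stretch`).

Both integrations by parts need `w` to close up around the circle, and this is where invariance
enters. Shifting `c` along itself by a constant arc length preserves the speed, and `G_c` depends on
`c` only through its speed. Such shifts are therefore isometries of `G_c`, and the derivative of
`G_c(h, h)` along them is a multiple of `w(c, h)(2π)`, which must vanish (`wTerm_two_pi`).

On the other side, `D_{c,h} G_c(h, k)` is the pairing of `k` with `(D_{c,h} A_c) h + ⟨D_s h, v⟩ A_c
h`. Inverting `A_c` on the difference gives `S_c(h)` (`metric_eq_of_opA_eq_neg_sprayTerm`). By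
`hasDerivAt_energy` the first variation of the energy is `∫ G_c(S_c(c_t) - c_tt, m) dt`; bump
variations and positivity of `G_c` yield the spray equation. The product rule `(A_c c_t)_t =
(D_{c,c_t} A_c) c_t + A_c c_tt` and injectivity of `A_c` turn it into the geodesic equation.

Throughout, smoothness means joint smoothness in parameters and `θ`. This makes pointwise
derivatives into limits in the Fréchet topology (`tendsto_velocity`) and reduces the calculus to
finite-dimensional parameters. -/

theorem hasFDerivAt_intervalIntegral {P E : Type*} [NormedAddCommGroup P] [NormedSpace ℝ P]
    [FiniteDimensional ℝ P] [NormedAddCommGroup E] [NormedSpace ℝ E] [CompleteSpace E]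
    {f : P × ℝ → E} (hf : ContDiff ℝ 1 f) (a b : ℝ) (p : P) :
    HasFDerivAt (fun p => ∫ t in a..b, f (p, t))
      (∫ t in a..b, (fderiv ℝ f (p, t)).comp (ContinuousLinearMap.inl ℝ P ℝ)) p := by
  have : ProperSpace P := FiniteDimensional.proper_real P
  have hF' : Continuous fun x : P × ℝ =>
      (fderiv ℝ f x).comp (ContinuousLinearMap.inl ℝ P ℝ) :=
    (hf.continuous_fderiv one_ne_zero).clm_comp continuous_const
  -- Finite dimension of `P` makes the closed unit ball compact, so one constant dominates the
  -- derivative near `p`.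
  obtain ⟨C, hC⟩ := ((isCompact_closedBall p 1).prod isCompact_uIcc).exists_bound_of_continuousOn
    (hF'.continuousOn (s := Metric.closedBall p 1 ×ˢ Set.uIcc a b))
  refine intervalIntegral.hasFDerivAt_integral_of_dominated_of_fderiv_le
    (F := fun p t => f (p, t))
    (F' := fun p t => (fderiv ℝ f (p, t)).comp (ContinuousLinearMap.inl ℝ P ℝ))
    (bound := fun _ => C) (Metric.closedBall_mem_nhds p one_pos) ?_ ?_ ?_ ?_ ?_ ?_
  · exact Filter.Eventually.of_forall fun q =>
      (hf.continuous.comp (Continuous.prodMk_right q)).aestronglyMeasurable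
  · exact (hf.continuous.comp (Continuous.prodMk_right p)).intervalIntegrable _ _
  · exact (hF'.comp (Continuous.prodMk_right p)).aestronglyMeasurable
  · exact Filter.Eventually.of_forall fun t ht q hq =>
      hC (q, t) ⟨hq, Set.uIoc_subset_uIcc ht⟩
  · exact intervalIntegrable_const
  · refine Filter.Eventually.of_forall fun t _ q _ => ?_
    exact (hf.differentiable one_ne_zero (q, t)).hasFDerivAt.comp q (hasFDerivAt_prodMk_left q t)

/-- The derivative in a fixed direction `v` is an integral of the same kind, with integrand `fderiv
ℝ f · (v, 0)`. The induction on the order therefore runs over all smooth `f`. -/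
theorem contDiff_intervalIntegral {P E : Type*} [NormedAddCommGroup P] [NormedSpace ℝ P]
    [FiniteDimensional ℝ P] [NormedAddCommGroup E] [NormedSpace ℝ E] [CompleteSpace E]
    {f : P × ℝ → E} (hf : ContDiff ℝ ∞ f) (a b : ℝ) :
    ContDiff ℝ ∞ (fun p => ∫ t in a..b, f (p, t)) := by
  rw [contDiff_infty]
  intro n
  induction n generalizing f with
  | zero =>
    rw [Nat.cast_zero, contDiff_zero]
    exact intervalIntegral.continuous_parametric_intervalIntegral_of_continuous'
      (f := fun p t => f (p, t)) hf.continuous a b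
  | succ n ih =>
    rw [Nat.cast_succ, contDiff_succ_iff_fderiv_apply]
    have h1 := hasFDerivAt_intervalIntegral (hf.of_le (by exact_mod_cast le_top)) a b
    have h2 : ContDiff ℝ ∞ (fderiv ℝ f) := hf.fderiv_right (by simp)
    refine ⟨fun p => (h1 p).differentiableAt, by simp, fun v => ?_⟩
    convert ih (f := fun x => fderiv ℝ f x (v, 0)) (h2.clm_apply contDiff_const) using 2 with p
    rw [(h1 p).fderiv, ContinuousLinearMap.intervalIntegral_apply]
    · simp
    · exact Continuous.intervalIntegrable ((h2.continuous.comp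
        (Continuous.prodMk_right p)).clm_comp continuous_const) _ _

theorem contDiff_primitive {P E : Type*} [NormedAddCommGroup P] [NormedSpace ℝ P]
    [FiniteDimensional ℝ P] [NormedAddCommGroup E] [NormedSpace ℝ E] [CompleteSpace E]
    {f : P × ℝ → E} (hf : ContDiff ℝ ∞ f) :
    ContDiff ℝ ∞ (fun x : P × ℝ => ∫ t in (0 : ℝ)..x.2, f (x.1, t)) := by
  -- The substitution `t = x.2 * s` moves the variable endpoint into the integrand.
  have h : (fun x : P × ℝ => ∫ t in (0 : ℝ)..x.2, f (x.1, t))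
      = fun x => x.2 • ∫ s in (0 : ℝ)..1, f (x.1, x.2 * s) := by
    funext x
    rw [intervalIntegral.smul_integral_comp_mul_left (fun t => f (x.1, t))]
    simp
  rw [h]
  refine contDiff_snd.smul (contDiff_intervalIntegral
    (f := fun y : (P × ℝ) × ℝ => f (y.1.1, y.1.2 * y.2)) ?_ 0 1)
  fun_prop

/-- The partial derivative of a smooth function with respect to a real parameter. -/
theorem hasDerivAt_fst {E : Type*} [NormedAddCommGroup E] [NormedSpace ℝ E] {Q : Type*}
    [NormedAddCommGroup Q] [NormedSpace ℝ Q] {f : ℝ × Q → E}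
    (hf : ContDiff ℝ ∞ f) (t : ℝ) (q : Q) :
    HasDerivAt (fun τ => f (τ, q)) (fderiv ℝ f (t, q) (1, 0)) t :=
  ((hf.differentiable (by simp) (t, q)).hasFDerivAt).comp_hasDerivAt t
    ((hasDerivAt_id t).prodMk (hasDerivAt_const t q))

theorem hasDerivAt_snd {E : Type*} [NormedAddCommGroup E] [NormedSpace ℝ E] {Q : Type*}
    [NormedAddCommGroup Q] [NormedSpace ℝ Q] {f : Q × ℝ → E}
    (hf : ContDiff ℝ ∞ f) (q : Q) (t : ℝ) :
    HasDerivAt (fun τ => f (q, τ)) (fderiv ℝ f (q, t) (0, 1)) t :=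
  ((hf.differentiable (by simp) (q, t)).hasFDerivAt).comp_hasDerivAt t
    ((hasDerivAt_const t q).prodMk (hasDerivAt_id t))

theorem contDiff_deriv_fst {E : Type*} [NormedAddCommGroup E] [NormedSpace ℝ E] {Q : Type*}
    [NormedAddCommGroup Q] [NormedSpace ℝ Q] {f : ℝ × Q → E} (hf : ContDiff ℝ ∞ f) :
    ContDiff ℝ ∞ (fun x : ℝ × Q => deriv (fun τ => f (τ, x.2)) x.1) := by
  have h : (fun x : ℝ × Q => deriv (fun τ => f (τ, x.2)) x.1) = fun x => fderiv ℝ f x (1, 0) :=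
    funext fun x => (hasDerivAt_fst hf x.1 x.2).deriv
  rw [h]
  exact (hf.fderiv_right (m := ∞) (by simp)).clm_apply contDiff_const

theorem contDiff_deriv_snd {E : Type*} [NormedAddCommGroup E] [NormedSpace ℝ E] {Q : Type*}
    [NormedAddCommGroup Q] [NormedSpace ℝ Q] {f : Q × ℝ → E} (hf : ContDiff ℝ ∞ f) :
    ContDiff ℝ ∞ (fun x : Q × ℝ => deriv (fun τ => f (x.1, τ)) x.2) := by
  have h : (fun x : Q × ℝ => deriv (fun τ => f (x.1, τ)) x.2) = fun x => fderiv ℝ f x (0, 1) :=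
    funext fun x => (hasDerivAt_snd hf x.1 x.2).deriv
  rw [h]
  exact (hf.fderiv_right (m := ∞) (by simp)).clm_apply contDiff_const

/-- Differentiation under the integral sign. -/
theorem hasDerivAt_intervalIntegral {E : Type*} [NormedAddCommGroup E] [NormedSpace ℝ E]
    [CompleteSpace E] {f : ℝ × ℝ → E} (hf : ContDiff ℝ ∞ f) (a b t : ℝ) :
    HasDerivAt (fun τ => ∫ θ in a..b, f (τ, θ))
      (∫ θ in a..b, deriv (fun τ => f (τ, θ)) t) t := by
  have h := (hasFDerivAt_intervalIntegral (hf.of_le (by exact_mod_cast le_top)) a b t).hasDerivAt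
  rw [ContinuousLinearMap.intervalIntegral_apply] at h
  · convert h using 3 with θ
    rw [(hasDerivAt_fst hf t θ).deriv]
    simp
  · exact Continuous.intervalIntegrable (((hf.continuous_fderiv (by simp)).comp
        (Continuous.prodMk_right t)).clm_comp continuous_const) _ _

/-- The derivative along the diagonal is the sum of the partial derivatives. -/
theorem hasDerivAt_diagonal {E : Type*} [NormedAddCommGroup E] [NormedSpace ℝ E]
    {f : ℝ × ℝ → E} (hf : ContDiff ℝ ∞ f) (t : ℝ) :
    HasDerivAt (fun τ => f (τ, τ))
      (deriv (fun τ => f (τ, t)) t + deriv (fun τ => f (t, τ)) t) t := by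
  rw [(hasDerivAt_fst hf t t).deriv, (hasDerivAt_snd hf t t).deriv, ← map_add]
  have := ((hf.differentiable (by simp) (t, t)).hasFDerivAt).comp_hasDerivAt (f := fun τ => (τ, τ))
    t ((hasDerivAt_id t).prodMk (hasDerivAt_id t))
  simpa [Function.comp_def] using this

theorem deriv_deriv_comm {E : Type*} [NormedAddCommGroup E] [NormedSpace ℝ E]
    {f : ℝ × ℝ → E} (hf : ContDiff ℝ ∞ f) (t θ : ℝ) :
    deriv (fun σ => deriv (fun τ => f (τ, σ)) t) θ
      = deriv (fun τ => deriv (fun σ => f (τ, σ)) θ) t := by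
  have h1 : (fun σ => deriv (fun τ => f (τ, σ)) t) = fun σ => fderiv ℝ f (t, σ) (1, 0) :=
    funext fun σ => (hasDerivAt_fst hf t σ).deriv
  have h2 : (fun τ => deriv (fun σ => f (τ, σ)) θ) = fun τ => fderiv ℝ f (τ, θ) (0, 1) :=
    funext fun τ => (hasDerivAt_snd hf τ θ).deriv
  have hf' : ContDiff ℝ ∞ (fderiv ℝ f) := hf.fderiv_right (by simp)
  have hsymm : IsSymmSndFDerivAt ℝ f (t, θ) :=
    hf.contDiffAt.isSymmSndFDerivAt
      (by
      simp only [minSmoothness_of_isRCLikeNormedField]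
      exact WithTop.coe_le_coe.2 (le_top (a := (2 : ℕ∞))))
  have h3 := (hasDerivAt_snd hf' t θ).clm_apply (hasDerivAt_const θ ((1 : ℝ), (0 : ℝ)))
  have h4 := (hasDerivAt_fst hf' t θ).clm_apply (hasDerivAt_const t ((0 : ℝ), (1 : ℝ)))
  rw [h1, h2, h3.deriv, h4.deriv, map_zero, add_zero, add_zero]
  exact hsymm.eq _ _

/-! ### The topology of the space of loops -/

theorem isSmoothFamily_iteratedDeriv {d : ℕ} {P : Type} [NormedAddCommGroup P] [NormedSpace ℝ P]
    {γ : P → Loop d} (hγ : IsSmoothFamily γ) (n : ℕ) :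
    ContDiff ℝ ∞ (fun x : P × ℝ => iteratedDeriv n (γ x.1) x.2) := by
  induction n with
  | zero =>
    simp only [iteratedDeriv_zero]
    exact hγ
  | succ n ih =>
    simp only [iteratedDeriv_succ]
    exact contDiff_deriv_snd ih

theorem Loop.continuous_eval {d : ℕ} (θ : ℝ) : Continuous (fun h : Loop d => h θ) := by
  have h1 : Continuous (Loop.jets d) := continuous_induced_dom
  have h2 : Continuous fun h : Loop d => (Loop.jets d h) 0 θ :=
    (ContinuousEvalConst.continuous_eval_const θ).comp ((continuous_apply 0).comp h1)
  convert h2 using 2 with h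
  simp [Loop.jets]

theorem Loop.tendsto_iff {d : ℕ} {ι : Type*} {l : Filter ι} {f : ι → Loop d} {g : Loop d} :
    Filter.Tendsto f l (𝓝 g) ↔
      ∀ n, Filter.Tendsto (fun i => Loop.jets d (f i) n) l (𝓝 (Loop.jets d g n)) := by
  have h : Topology.IsInducing (Loop.jets d) := ⟨rfl⟩
  rw [h.tendsto_nhds_iff, tendsto_pi_nhds]
  rfl

theorem hasDerivAt_velocity {d : ℕ} {γ : ℝ → Loop d} (hγ : IsSmoothFamily γ) (t θ : ℝ) :
    HasDerivAt (fun τ => γ τ θ) (velocity γ hγ t θ) t :=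
  (hasDerivAt_fst (f := fun p : ℝ × ℝ => γ p.1 p.2) hγ t θ).differentiableAt.hasDerivAt

theorem iteratedDeriv_velocity {d : ℕ} {γ : ℝ → Loop d} (hγ : IsSmoothFamily γ) (n : ℕ) (t θ : ℝ) :
    iteratedDeriv n (velocity γ hγ t) θ = deriv (fun τ => iteratedDeriv n (γ τ) θ) t := by
  induction n generalizing θ with
  | zero => simp only [iteratedDeriv_zero]; rfl
  | succ n ih =>
    simp only [iteratedDeriv_succ]
    rw [funext ih]
    exact deriv_deriv_comm (isSmoothFamily_iteratedDeriv hγ n) t θ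

/-- A smooth curve of loops is differentiable in the Fréchet topology. -/
theorem tendsto_velocity {d : ℕ} {γ : ℝ → Loop d} (hγ : IsSmoothFamily γ) (t : ℝ) :
    Filter.Tendsto (fun ε : ℝ => ε⁻¹ • (γ (t + ε) - γ t)) (𝓝[≠] 0) (𝓝 (velocity γ hγ t)) := by
  rw [Loop.tendsto_iff]
  intro n
  let g : ℝ × ℝ → Vec d := fun x => iteratedDeriv n (γ x.1) x.2
  have hg : ContDiff ℝ ∞ g := isSmoothFamily_iteratedDeriv hγ n
  let g' : ℝ × ℝ → Vec d := fun x => fderiv ℝ g x (1, 0)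
  have hg' : ContDiff ℝ ∞ g' := (hg.fderiv_right (m := ∞) (by simp)).clm_apply contDiff_const
  -- For `ε ≠ 0` the difference quotient is the mean of the time derivative over the segment from
  -- `t` to `t + ε`. This mean is also defined at `ε = 0` and is jointly continuous; currying turns
  -- joint continuity into convergence in `C(ℝ, Vec d)`.
  let q : ℝ × ℝ → Vec d := fun x => ∫ s in (0 : ℝ)..1, g' (t + x.1 * s, x.2)
  have hq : Continuous q :=
    (contDiff_intervalIntegral (f := fun y : (ℝ × ℝ) × ℝ => g' (t + y.1.1 * y.2, y.1.2))
      (by fun_prop) 0 1).continuous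
  let Q : C(ℝ, C(ℝ, Vec d)) := ContinuousMap.curry ⟨q, hq⟩
  have hQ : Filter.Tendsto Q (𝓝[≠] 0) (𝓝 (Q 0)) :=
    (Q.continuous.tendsto 0).mono_left nhdsWithin_le_nhds
  have hQε : ∀ ε : ℝ, ε ≠ 0 → Loop.jets d (ε⁻¹ • (γ (t + ε) - γ t)) n = Q ε := by
    intro ε hε
    rw [map_smul, map_sub]
    ext1 θ
    change ε⁻¹ • (g (t + ε, θ) - g (t, θ)) = ∫ s in (0 : ℝ)..1, g' (t + ε * s, θ)
    have h1 : (∫ s in (0 : ℝ)..1, g' (t + ε * s, θ))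
        = ε⁻¹ • ∫ s in (t + ε * 0)..(t + ε * 1), g' (s, θ) :=
      intervalIntegral.integral_comp_add_mul (fun s => g' (s, θ)) hε t
    have h2 : (∫ s in (t + ε * 0)..(t + ε * 1), g' (s, θ)) = g (t + ε * 1, θ) - g (t + ε * 0, θ) :=
      intervalIntegral.integral_eq_sub_of_hasDerivAt (fun s _ => hasDerivAt_fst hg s θ)
        ((hg'.continuous.comp (Continuous.prodMk_left θ)).intervalIntegrable _ _)
    rw [h1, h2, mul_one, mul_zero, add_zero]
  have hQ0 : Q 0 = Loop.jets d (velocity γ hγ t) n := by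
    ext1 θ
    change (∫ s in (0 : ℝ)..1, g' (t + 0 * s, θ)) = iteratedDeriv n (velocity γ hγ t) θ
    rw [iteratedDeriv_velocity hγ]
    simp only [zero_mul, add_zero, intervalIntegral.integral_const, sub_zero, one_smul]
    exact (hasDerivAt_fst hg t θ).deriv.symm
  rw [← hQ0]
  refine hQ.congr' ?_
  filter_upwards [self_mem_nhdsWithin] with ε hε
  exact (hQε ε hε).symm

/-! ### Smooth families of diffeomorphisms -/

/-- The inverses of a smooth family of diffeomorphisms form a smooth family. -/
theorem CircleDiff.contDiff_symm {P : Type*} [NormedAddCommGroup P] [NormedSpace ℝ P]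
    [FiniteDimensional ℝ P] {φ : P → CircleDiff} (hφ : ContDiff ℝ ∞ fun x : P × ℝ => φ x.1 x.2) :
    ContDiff ℝ ∞ fun x : P × ℝ => (φ x.1).symm x.2 := by
  -- The derivative of `Φ` is triangular with the nonzero entry `∂_θ φ`, hence invertible. The
  -- second component of a local inverse of `Φ` is the family of inverses.
  let Φ : P × ℝ → P × ℝ := fun x => (x.1, φ x.1 x.2)
  have hΦ : ContDiff ℝ ∞ Φ := contDiff_fst.prodMk hφ
  rw [contDiff_iff_contDiffAt]
  rintro ⟨p, y⟩
  obtain ⟨θ, rfl⟩ := (φ p).surjective y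
  let f' : P × ℝ →L[ℝ] P × ℝ := fderiv ℝ Φ (p, θ)
  have hf' : HasFDerivAt Φ f' (p, θ) := (hΦ.differentiable (by simp) _).hasFDerivAt
  have hf'eq : ∀ x, f' x = (x.1, fderiv ℝ (fun x : P × ℝ => φ x.1 x.2) (p, θ) x) := fun x => by
    have h := (hasFDerivAt_fst (𝕜 := ℝ) (p := (p, θ))).prodMk
      (hφ.differentiable (by simp) (p, θ)).hasFDerivAt
    rw [hf'.unique h]
    rfl
  have hinj : Function.Injective (f' : P × ℝ →ₗ[ℝ] P × ℝ) := by
    rw [← LinearMap.ker_eq_bot, LinearMap.ker_eq_bot']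
    rintro ⟨v, s⟩ hx
    rw [ContinuousLinearMap.coe_coe, hf'eq, Prod.mk_eq_zero] at hx
    obtain ⟨rfl : v = 0, h2⟩ := hx
    have h3 : ((0 : P), s) = s • ((0 : P), (1 : ℝ)) := by simp
    rw [h3, map_smul, ← (hasDerivAt_snd hφ p θ).deriv, smul_eq_mul] at h2
    have h4 := (mul_eq_zero.1 h2).resolve_right ((φ p).deriv_pos θ).ne'
    rw [h4]
    rfl
  let e' : (P × ℝ) ≃L[ℝ] P × ℝ :=
    (LinearEquiv.ofInjectiveEndo (f' : P × ℝ →ₗ[ℝ] P × ℝ) hinj).toContinuousLinearEquiv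
  have he' : HasFDerivAt Φ (e' : P × ℝ →L[ℝ] P × ℝ) (p, θ) := by
    convert hf' using 1
    exact ContinuousLinearMap.ext fun _ => rfl
  let e := hΦ.contDiffAt.toOpenPartialHomeomorph Φ he' (by simp)
  have h1 : ContDiffAt ℝ ∞ (hΦ.contDiffAt.localInverse he' (by simp)) (Φ (p, θ)) :=
    hΦ.contDiffAt.to_localInverse he' (by simp)
  refine (contDiff_snd.contDiffAt.comp _ h1).congr_of_eventuallyEq ?_
  filter_upwards [e.open_target.mem_nhds
    (hΦ.contDiffAt.image_mem_toOpenPartialHomeomorph_target he' (by simp))] with z hz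
  have h2 : Φ (e.symm z) = z := e.right_inv hz
  have h3 : (e.symm z).1 = z.1 := (congrArg Prod.fst h2 : (Φ (e.symm z)).1 = z.1)
  have h4 : φ z.1 (e.symm z).2 = z.2 := by
    rw [← h3]
    exact (congrArg Prod.snd h2 : (Φ (e.symm z)).2 = z.2)
  change (φ z.1).symm z.2 = (e.symm z).2
  rw [← h4, CircleDiff.symm_apply_apply]

theorem isSmoothFamily_reparam {d : ℕ} {P : Type} [NormedAddCommGroup P] [NormedSpace ℝ P]
    {φ : P → CircleDiff} (hφ : ContDiff ℝ ∞ fun x : P × ℝ => φ x.1 x.2)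
    {h : P → Loop d} (hh : IsSmoothFamily h) : IsSmoothFamily fun p => reparam (φ p) (h p) :=
  ContDiff.comp (g := fun x : P × ℝ => h x.1 x.2) (f := fun x : P × ℝ => (x.1, φ x.1 x.2)) hh
    (contDiff_fst.prodMk hφ)

theorem reparam_apply {d : ℕ} (φ : CircleDiff) (h : Loop d) (θ : ℝ) :
    reparam φ h θ = h (φ θ) := rfl

theorem reparam_symm_reparam {d : ℕ} (φ : CircleDiff) (h : Loop d) :
    reparam φ.symm (reparam φ h) = h :=
  Loop.ext fun θ => by rw [reparam_apply, reparam_apply, φ.apply_symm_apply]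

theorem reparam_reparam_symm {d : ℕ} (φ : CircleDiff) (h : Loop d) :
    reparam φ (reparam φ.symm h) = h :=
  Loop.ext fun θ => by rw [reparam_apply, reparam_apply, φ.symm_apply_apply]

theorem bijective_reparam {d : ℕ} (φ : CircleDiff) :
    Function.Bijective (reparam (d := d) φ) :=
  Function.bijective_iff_has_inverse.2
    ⟨reparam φ.symm, reparam_symm_reparam φ, reparam_reparam_symm φ⟩

/-! ### Smooth families of immersions -/

section Families

variable {d : ℕ} {P : Type} [NormedAddCommGroup P] [NormedSpace ℝ P]

theorem isSmoothFamily_const (h : Loop d) : IsSmoothFamily fun _ : P => h :=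
  h.contDiff.comp contDiff_snd

theorem contDiff_speed_family {c : P → Imm d} (hc : IsSmoothFamily fun p => (c p).loop) :
    ContDiff ℝ ∞ fun x : P × ℝ => speed (c x.1) x.2 :=
  (contDiff_deriv_snd (f := fun x : P × ℝ => (c x.1).loop x.2) hc).norm ℝ
    fun x => (c x.1).deriv_ne_zero x.2

variable [FiniteDimensional ℝ P]

theorem contDiff_len_family {c : P → Imm d} (hc : IsSmoothFamily fun p => (c p).loop) :
    ContDiff ℝ ∞ fun p => len (c p) :=
  contDiff_intervalIntegral (contDiff_speed_family hc) _ _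

theorem contDiff_psi_family {c : P → Imm d} (hc : IsSmoothFamily fun p => (c p).loop) :
    ContDiff ℝ ∞ fun x : P × ℝ => psi (c x.1) x.2 :=
  (contDiff_const.div ((contDiff_len_family hc).comp contDiff_fst) fun _ => (len_pos _).ne').mul
    (contDiff_primitive (contDiff_speed_family hc))

theorem isSmoothFamily_opA {A : ℝ → Loop d →L[ℝ] Loop d} (hA : IsSmoothOperatorFamily A)
    {c : P → Imm d} (hc : IsSmoothFamily fun p => (c p).loop) {h : P → Loop d}
    (hh : IsSmoothFamily h) : IsSmoothFamily fun p => opA A (c p) (h p) := by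
  have h1 : IsSmoothFamily fun p => reparam (psi (c p)).symm (h p) :=
    isSmoothFamily_reparam (φ := fun p => (psi (c p)).symm)
      (CircleDiff.contDiff_symm (φ := fun p => psi (c p)) (contDiff_psi_family hc)) hh
  have h2 := hA P (fun p => len (c p)) _ (contDiff_len_family hc) (fun p => len_pos _) h1
  have h3 : IsSmoothFamily fun p => reparam (psi (c p)) (A (len (c p))
      (reparam (psi (c p)).symm (h p))) :=
    isSmoothFamily_reparam (φ := fun p => psi (c p)) (contDiff_psi_family hc) h2
  exact h3

theorem contDiff_metric_integrand {A : ℝ → Loop d →L[ℝ] Loop d} (hA : IsSmoothOperatorFamily A)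
    {c : P → Imm d} (hc : IsSmoothFamily fun p => (c p).loop) {h k : P → Loop d}
    (hh : IsSmoothFamily h) (hk : IsSmoothFamily k) :
    ContDiff ℝ ∞ fun x : P × ℝ =>
      inner ℝ (opA A (c x.1) (h x.1) x.2) (k x.1 x.2) * speed (c x.1) x.2 :=
  (ContDiff.inner ℝ (isSmoothFamily_opA hA hc hh) hk).mul (contDiff_speed_family hc)

theorem contDiff_metric {A : ℝ → Loop d →L[ℝ] Loop d} (hA : IsSmoothOperatorFamily A)
    {c : P → Imm d} (hc : IsSmoothFamily fun p => (c p).loop) {h k : P → Loop d}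
    (hh : IsSmoothFamily h) (hk : IsSmoothFamily k) :
    ContDiff ℝ ∞ fun p => metric A (c p) (h p) (k p) :=
  contDiff_intervalIntegral (contDiff_metric_integrand hA hc hh hk) _ _

end Families

theorem IsSmoothFamily.comp {d : ℕ} {P Q : Type} [NormedAddCommGroup P] [NormedSpace ℝ P]
    [NormedAddCommGroup Q] [NormedSpace ℝ Q] {γ : P → Loop d} (hγ : IsSmoothFamily γ)
    {f : Q → P} (hf : ContDiff ℝ ∞ f) : IsSmoothFamily fun q => γ (f q) :=
  ContDiff.comp (g := fun x : P × ℝ => γ x.1 x.2) (f := fun x : Q × ℝ => (f x.1, x.2)) hγ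
    ((hf.comp contDiff_fst).prodMk contDiff_snd)

theorem bijective_opA {d : ℕ} {A : ℝ → Loop d →L[ℝ] Loop d}
    (hA : ∀ l : ℝ, 0 < l → (A l).IsInvertible) (c : Imm d) : Function.Bijective (opA A c) :=
  (bijective_reparam _).comp ((hA _ (len_pos c)).bijective.comp (bijective_reparam _))

/-! ### Derivatives along curves of loops -/

variable {d : ℕ}

theorem velocity_eq_of_hasDerivAt {γ : ℝ → Loop d} (hγ : IsSmoothFamily γ) {t : ℝ} {m : Loop d}
    (h : ∀ θ, HasDerivAt (fun τ => γ τ θ) (m θ) t) : velocity γ hγ t = m :=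
  Loop.ext fun θ => (hasDerivAt_velocity hγ t θ).unique (h θ)

theorem hasDerivAt_iff_tendsto_inv_smul {E : Type*} [NormedAddCommGroup E] [NormedSpace ℝ E]
    {f : ℝ → E} {f' : E} {t : ℝ} :
    HasDerivAt f f' t ↔
      Filter.Tendsto (fun ε : ℝ => ε⁻¹ • (f (t + ε) - f t)) (𝓝[≠] 0) (𝓝 f') :=
  hasDerivAt_iff_tendsto_slope_zero

/-- The difference quotients of `γ` converge in the Fréchet topology, so continuity of `T` and of
evaluation carries the limit through. -/
theorem hasDerivAt_clm (T : Loop d →L[ℝ] Loop d) {γ : ℝ → Loop d} (hγ : IsSmoothFamily γ)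
    (t θ : ℝ) : HasDerivAt (fun τ => T (γ τ) θ) (T (velocity γ hγ t) θ) t := by
  rw [hasDerivAt_iff_tendsto_inv_smul]
  have h := (((Loop.continuous_eval θ).comp T.continuous).tendsto _).comp (tendsto_velocity hγ t)
  refine h.congr fun ε => ?_
  simp only [Function.comp_apply, map_smul, map_sub]
  rfl

theorem isSmoothFamily_reparam_const {P : Type} [NormedAddCommGroup P] [NormedSpace ℝ P]
    (φ : CircleDiff) {γ : P → Loop d} (hγ : IsSmoothFamily γ) :
    IsSmoothFamily fun p => reparam φ (γ p) :=
  isSmoothFamily_reparam (φ := fun _ => φ) (φ.smooth.comp contDiff_snd) hγ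

theorem hasDerivAt_opA_const (A : ℝ → Loop d →L[ℝ] Loop d) (c : Imm d) {γ : ℝ → Loop d}
    (hγ : IsSmoothFamily γ) (t θ : ℝ) :
    HasDerivAt (fun τ => opA A c (γ τ) θ) (opA A c (velocity γ hγ t) θ) t :=
  hasDerivAt_clm (A (len c)) (isSmoothFamily_reparam_const (psi c).symm hγ) t (psi c θ)

/-- Smoothness of `A` is only tested on parameter functions that are positive everywhere. The
parametrization `λ = exp x` covers `(0, ∞)`, and `log` brings the derivative back to `λ`. -/
theorem differentiableAt_operator {A : ℝ → Loop d →L[ℝ] Loop d} (hA : IsSmoothOperatorFamily A)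
    (h : Loop d) (θ : ℝ) {l : ℝ} (hl : 0 < l) :
    DifferentiableAt ℝ (fun l => A l h θ) l := by
  have h1 := hA ℝ Real.exp _ Real.contDiff_exp Real.exp_pos (isSmoothFamily_const h)
  have h2 : DifferentiableAt ℝ (fun l => A (Real.exp (Real.log l)) h θ) l :=
    DifferentiableAt.comp (g := fun x => A (Real.exp x) h θ) l
      (hasDerivAt_velocity h1 (Real.log l) θ).differentiableAt (Real.differentiableAt_log hl.ne')
  refine h2.congr_of_eventuallyEq ?_
  filter_upwards [lt_mem_nhds hl] with x hx
  rw [Real.exp_log hx]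

theorem hasDerivAt_operator {A : ℝ → Loop d →L[ℝ] Loop d} (hA : IsSmoothOperatorFamily A)
    {l : ℝ → ℝ} (hl : ContDiff ℝ ∞ l) (hl0 : ∀ t, 0 < l t) {h : ℝ → Loop d}
    (hh : IsSmoothFamily h) (t θ : ℝ) :
    HasDerivAt (fun τ => A (l τ) (h τ) θ)
      (deriv l t • deriv (fun l => A l (h t) θ) (l t) + A (l t) (velocity h hh t) θ) t := by
  have h1 : IsSmoothFamily fun p : ℝ × ℝ => A (l p.1) (h p.2) :=
    hA (ℝ × ℝ) (fun p => l p.1) (fun p => h p.2) (hl.comp contDiff_fst) (fun p => hl0 _)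
      (hh.comp contDiff_snd)
  have h2 : ContDiff ℝ ∞ fun p : ℝ × ℝ => A (l p.1) (h p.2) θ :=
    ContDiff.comp (g := fun x : (ℝ × ℝ) × ℝ => A (l x.1.1) (h x.1.2) x.2) (f := fun p => (p, θ))
      h1 (contDiff_id.prodMk contDiff_const)
  have h3 := hasDerivAt_diagonal h2 t
  have h4 : HasDerivAt (fun τ => A (l τ) (h t) θ)
      (deriv l t • deriv (fun l => A l (h t) θ) (l t)) t :=
    HasDerivAt.scomp t (differentiableAt_operator hA (h t) θ (hl0 t)).hasDerivAt
      (hl.differentiable (by simp) t).hasDerivAt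
  have h5 := (hasDerivAt_clm (A (l t)) hh t θ).deriv
  rwa [h4.deriv, h5] at h3

/-! ### Derivatives along curves of immersions -/

theorem Loop.differentiable (h : Loop d) : Differentiable ℝ h.toFun :=
  h.contDiff.differentiable (by simp)

theorem Loop.contDiff_deriv (h : Loop d) : ContDiff ℝ ∞ (deriv h.toFun) :=
  (contDiff_infty_iff_deriv.1 h.contDiff).2

theorem Loop.deriv_periodic (h : Loop d) (θ : ℝ) :
    deriv h.toFun (θ + 2 * Real.pi) = deriv h.toFun θ := by
  rw [← deriv_comp_add_const]
  simp only [Loop.periodic]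

theorem hasDerivAt_deriv_velocity {γ : ℝ → Loop d} (hγ : IsSmoothFamily γ) (t θ : ℝ) :
    HasDerivAt (fun τ => deriv (γ τ) θ) (deriv (velocity γ hγ t) θ) t := by
  have h1 := hasDerivAt_fst (contDiff_deriv_snd (f := fun x : ℝ × ℝ => γ x.1 x.2) hγ) t θ
  have h2 := deriv_deriv_comm (f := fun x : ℝ × ℝ => γ x.1 x.2) hγ t θ
  have h3 := h1.differentiableAt.hasDerivAt
  exact h2 ▸ h3

/-- The rate `⟨D_s m, v⟩ |c'|` at which the speed `|c'|` changes when `c` moves with velocity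
`m`. -/
def stretch (c : Imm d) (m : Loop d) (θ : ℝ) : ℝ := inner ℝ (deriv m θ) (tangent c θ)

theorem stretch_eq (c : Imm d) (m : Loop d) (θ : ℝ) :
    stretch c m θ = inner ℝ (arcDeriv c m θ) (tangent c θ) * speed c θ := by
  rw [stretch, arcDeriv, real_inner_smul_left, mul_comm, mul_inv_cancel_left₀ (speed_pos c θ).ne']

theorem contDiff_arcDeriv (c : Imm d) {f : ℝ → Vec d} (hf : ContDiff ℝ ∞ f) :
    ContDiff ℝ ∞ (arcDeriv c f) :=
  ((contDiff_speed c).inv fun θ => (speed_pos c θ).ne').smul (contDiff_infty_iff_deriv.1 hf).2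

theorem contDiff_tangent (c : Imm d) : ContDiff ℝ ∞ (tangent c) :=
  contDiff_arcDeriv c c.loop.contDiff

theorem contDiff_stretch (c : Imm d) (m : Loop d) : ContDiff ℝ ∞ (stretch c m) :=
  ContDiff.inner ℝ m.contDiff_deriv (contDiff_tangent c)

section Curve

variable {c : ℝ → Imm d} (hc : IsSmoothFamily fun t => (c t).loop)

theorem hasDerivAt_speed (t θ : ℝ) :
    HasDerivAt (fun τ => speed (c τ) θ) (stretch (c t) (pathVelocity c hc t) θ) t := by
  have h1 := hasDerivAt_deriv_velocity hc t θ
  -- The speed is already known to be differentiable; its derivative is read off by comparing two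
  -- derivatives of `|c'|²`.
  have h2 := (hasDerivAt_fst (contDiff_speed_family hc) t θ).differentiableAt.hasDerivAt
  have h3 := h2.pow 2
  have h4 := h1.norm_sq
  have h5 := h3.unique h4
  have h6 := speed_pos (c t) θ
  refine h2.congr_deriv ?_
  simp only [stretch, tangent, arcDeriv, real_inner_smul_right]
  symm
  rw [inv_mul_eq_div, div_eq_iff h6.ne', real_inner_comm]
  simp only [Nat.cast_ofNat, Nat.add_one_sub_one, pow_one] at h5
  change 2 * speed (c t) θ * _ = _ at h5
  change _ = 2 * inner ℝ (deriv (c t).loop θ) (deriv (pathVelocity c hc t) θ) at h5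
  linarith

theorem hasDerivAt_len (t : ℝ) :
    HasDerivAt (fun τ => len (c τ))
      (∫ θ in (0 : ℝ)..(2 * Real.pi), stretch (c t) (pathVelocity c hc t) θ) t := by
  refine (hasDerivAt_intervalIntegral (contDiff_speed_family hc) 0 (2 * Real.pi) t).congr_deriv ?_
  simp only [(hasDerivAt_speed hc t _).deriv]

/-- The derivative of `ψ_c(θ)` when `c` moves with velocity `m`. -/
def psiDeriv (c : Imm d) (m : Loop d) (θ : ℝ) : ℝ :=
  2 * Real.pi / len c * (∫ σ in (0 : ℝ)..θ, stretch c m σ)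
    - (∫ σ in (0 : ℝ)..(2 * Real.pi), stretch c m σ) / len c * psi c θ

theorem hasDerivAt_psi_path (t θ : ℝ) :
    HasDerivAt (fun τ => psi (c τ) θ) (psiDeriv (c t) (pathVelocity c hc t) θ) t := by
  have h1 : HasDerivAt (fun τ => ∫ σ in (0 : ℝ)..θ, speed (c τ) σ)
      (∫ σ in (0 : ℝ)..θ, stretch (c t) (pathVelocity c hc t) σ) t := by
    refine (hasDerivAt_intervalIntegral (contDiff_speed_family hc) 0 θ t).congr_deriv ?_
    simp only [(hasDerivAt_speed hc t _).deriv]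
  have h2 := (((hasDerivAt_len hc t).fun_inv (len_pos (c t)).ne').const_mul (2 * Real.pi)).mul h1
  have h3 : psi (c t) θ = 2 * Real.pi / len (c t) * ∫ σ in (0 : ℝ)..θ, speed (c t) σ := rfl
  refine h2.congr_deriv ?_
  rw [psiDeriv, h3]
  have := (len_pos (c t)).ne'
  field_simp
  ring

/-- Implicit differentiation: `F τ` solves `ψ_{c(τ)}(F τ) = ψ_{c(t)}(θ)`, whose right side is
constant in `τ`. -/
theorem hasDerivAt_psi_symm_path (t θ : ℝ) :
    HasDerivAt (fun τ => (psi (c τ)).symm (psi (c t) θ))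
      (-(psiDeriv (c t) (pathVelocity c hc t) θ / deriv (psi (c t)) θ)) t := by
  have h1 := contDiff_psi_family hc
  have h2 : ContDiff ℝ ∞ fun x : ℝ × ℝ => (psi (c x.1)).symm x.2 :=
    CircleDiff.contDiff_symm (φ := fun p => psi (c p)) h1
  have h3 := (hasDerivAt_fst h2 t (psi (c t) θ)).differentiableAt.hasDerivAt
  set F : ℝ → ℝ := fun τ => (psi (c τ)).symm (psi (c t) θ) with hF
  have hFt : F t = θ := (psi (c t)).symm_apply_apply θ
  have hFs : ContDiff ℝ ∞ F := 
    ContDiff.comp (g := fun x : ℝ × ℝ => (psi (c x.1)).symm x.2)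
      (f := fun τ : ℝ => (τ, psi (c t) θ)) h2 (contDiff_id.prodMk contDiff_const)
  have h4 := hasDerivAt_diagonal (f := fun x : ℝ × ℝ => psi (c x.1) (F x.2))
    (ContDiff.comp (g := fun x : ℝ × ℝ => psi (c x.1) x.2) (f := fun x : ℝ × ℝ => (x.1, F x.2)) h1
      (contDiff_fst.prodMk (hFs.comp contDiff_snd))) t
  have h5 : (fun τ => psi (c τ) (F τ)) = fun _ => psi (c t) θ :=
    funext fun τ => (psi (c τ)).apply_symm_apply _
  have h6 : HasDerivAt (fun τ => psi (c t) (F τ)) (deriv (psi (c t)) θ * deriv F t) t := by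
    have h7 : HasDerivAt (psi (c t)) (deriv (psi (c t)) θ) (F t) := by
      rw [hFt]
      exact ((psi (c t)).smooth.differentiable (by simp) θ).hasDerivAt
    exact h7.comp t h3
  simp only [h6.deriv, hFt, (hasDerivAt_psi_path hc t θ).deriv] at h4
  rw [h5] at h4
  have h8 := h4.unique (hasDerivAt_const t _)
  have h9 := ((psi (c t)).deriv_pos θ).ne'
  refine h3.congr_deriv ?_
  field_simp
  linarith

theorem isSmoothFamily_reparam_psi_symm {P : Type} [NormedAddCommGroup P] [NormedSpace ℝ P]
    [FiniteDimensional ℝ P] {c : P → Imm d} (hc : IsSmoothFamily fun t => (c t).loop)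
    {k : P → Loop d} (hk : IsSmoothFamily k) :
    IsSmoothFamily fun τ => reparam (psi (c τ)).symm (k τ) :=
  isSmoothFamily_reparam (φ := fun p => (psi (c p)).symm)
    (CircleDiff.contDiff_symm (φ := fun p => psi (c p)) (contDiff_psi_family hc)) hk

theorem velocity_reparam_psi_symm (k : Loop d) (t θ : ℝ) :
    velocity (fun τ => reparam (psi (c τ)).symm k)
      (isSmoothFamily_reparam_psi_symm hc (isSmoothFamily_const k)) t (psi (c t) θ)
      = -(psiDeriv (c t) (pathVelocity c hc t) θ / deriv (psi (c t)) θ) • deriv k θ := by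
  refine HasDerivAt.deriv ?_
  have h1 : HasDerivAt k (deriv k θ) ((psi (c t)).symm (psi (c t) θ)) := by
    rw [CircleDiff.symm_apply_apply]
    exact (k.differentiable θ).hasDerivAt
  exact HasDerivAt.scomp t h1 (hasDerivAt_psi_symm_path hc t θ)

/-- The curve enters `A_c k` in three places: the length, the inner `ψ_c⁻¹` and the outer `ψ_c`;
each contributes one summand. The form matters, since every summand is determined by the position
and velocity of the curve at time `t`. -/
theorem hasDerivAt_opA_path {A : ℝ → Loop d →L[ℝ] Loop d} (hA : IsSmoothOperatorFamily A)
    (k : Loop d) (t θ : ℝ) :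
    HasDerivAt (fun τ => opA A (c τ) k θ)
      ((∫ σ in (0 : ℝ)..(2 * Real.pi), stretch (c t) (pathVelocity c hc t) σ) • opA' A (c t) k θ
        + A (len (c t)) (velocity (fun τ => reparam (psi (c τ)).symm k)
            (isSmoothFamily_reparam_psi_symm hc (isSmoothFamily_const k)) t) (psi (c t) θ)
        + psiDeriv (c t) (pathVelocity c hc t) θ •
            deriv (A (len (c t)) (reparam (psi (c t)).symm k)) (psi (c t) θ)) t := by
  have h1 : IsSmoothFamily fun τ => reparam (psi (c τ)).symm k :=
    isSmoothFamily_reparam_psi_symm hc (isSmoothFamily_const k)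
  have h2 : IsSmoothFamily fun τ => A (len (c τ)) (reparam (psi (c τ)).symm k) :=
    hA ℝ (fun τ => len (c τ)) _ (contDiff_len_family hc) (fun _ => len_pos _) h1
  have h3 : ContDiff ℝ ∞ fun τ => psi (c τ) θ :=
    
    ContDiff.comp (g := fun x : ℝ × ℝ => psi (c x.1) x.2)
      (f := fun τ : ℝ => (τ, θ)) (contDiff_psi_family hc) (contDiff_id.prodMk contDiff_const)
  have h4 := hasDerivAt_diagonal (f := fun x : ℝ × ℝ =>
    A (len (c x.1)) (reparam (psi (c x.1)).symm k) (psi (c x.2) θ))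
    (ContDiff.comp (g := fun x : ℝ × ℝ => A (len (c x.1)) (reparam (psi (c x.1)).symm k) x.2)
      (f := fun x : ℝ × ℝ => (x.1, psi (c x.2) θ)) h2
      (contDiff_fst.prodMk (h3.comp contDiff_snd))) t
  have h5 := hasDerivAt_operator hA (contDiff_len_family hc) (fun _ => len_pos _) h1 t
    (psi (c t) θ)
  rw [(hasDerivAt_len hc t).deriv] at h5
  have h6 : HasDerivAt (fun τ => A (len (c t)) (reparam (psi (c t)).symm k) (psi (c τ) θ))
      (psiDeriv (c t) (pathVelocity c hc t) θ •
            deriv (A (len (c t)) (reparam (psi (c t)).symm k)) (psi (c t) θ)) t :=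
    HasDerivAt.scomp t ((A (len (c t)) (reparam (psi (c t)).symm k)).differentiable
      (psi (c t) θ)).hasDerivAt (hasDerivAt_psi_path hc t θ)
  simp only [h5.deriv, h6.deriv] at h4
  exact h4

end Curve

/-- The derivative of `c ↦ A_c k` along a curve depends on the velocity of the curve only. -/
theorem deriv_opA_path_congr {A : ℝ → Loop d →L[ℝ] Loop d} (hA : IsSmoothOperatorFamily A)
    {c₁ c₂ : ℝ → Imm d} (hc₁ : IsSmoothFamily fun t => (c₁ t).loop)
    (hc₂ : IsSmoothFamily fun t => (c₂ t).loop) {t₁ t₂ : ℝ} (h : c₁ t₁ = c₂ t₂)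
    (hv : pathVelocity c₁ hc₁ t₁ = pathVelocity c₂ hc₂ t₂) (k : Loop d) (θ : ℝ) :
    deriv (fun τ => opA A (c₁ τ) k θ) t₁ = deriv (fun τ => opA A (c₂ τ) k θ) t₂ := by
  have h1 : velocity (fun τ => reparam (psi (c₁ τ)).symm k)
      (isSmoothFamily_reparam_psi_symm hc₁ (isSmoothFamily_const k)) t₁
      = velocity (fun τ => reparam (psi (c₂ τ)).symm k)
      (isSmoothFamily_reparam_psi_symm hc₂ (isSmoothFamily_const k)) t₂ := by
    refine Loop.ext fun y => ?_
    obtain ⟨θ, rfl⟩ := (psi (c₁ t₁)).surjective y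
    rw [velocity_reparam_psi_symm hc₁, h, velocity_reparam_psi_symm hc₂, hv]
  rw [(hasDerivAt_opA_path hc₁ hA k t₁ θ).deriv, (hasDerivAt_opA_path hc₂ hA k t₂ θ).deriv,
    h1, h, hv]

/-! ### Variations of immersions -/

theorem exists_mem_Icc_deriv_eq (h k : Loop d) (θ : ℝ) : ∃ σ ∈ Set.Icc 0 (2 * Real.pi),
    deriv h.toFun θ = deriv h.toFun σ ∧ deriv k.toFun θ = deriv k.toFun σ := by
  have hp : Function.Periodic (fun θ => (deriv h.toFun θ, deriv k.toFun θ)) (2 * Real.pi) :=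
    fun θ => Prod.ext (h.deriv_periodic θ) (k.deriv_periodic θ)
  obtain ⟨σ, hσ, hσ'⟩ := hp.exists_mem_Ico₀ (by positivity) θ
  exact ⟨σ, ⟨hσ.1, hσ.2.le⟩, congrArg Prod.fst hσ', congrArg Prod.snd hσ'⟩

/-- A smooth family of immersions can be varied in every direction that is supported in a compact
set of parameters. -/
theorem exists_variation {P : Type} [NormedAddCommGroup P] [NormedSpace ℝ P]
    {c : P → Imm d} (hc : IsSmoothFamily fun p => (c p).loop) {m : P → Loop d}
    (hm : IsSmoothFamily m) {K : Set P} (hK : IsCompact K) (hmK : ∀ p ∉ K, m p = 0) :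
    ∃ (χ : ℝ → ℝ) (f : ℝ → P → Imm d), ContDiff ℝ ∞ χ ∧ χ 0 = 0 ∧ HasDerivAt χ 1 0 ∧
      ∀ ε p, (f ε p).loop = (c p).loop + χ ε • m p := by
  have hKc : IsCompact (K ×ˢ Set.Icc (0 : ℝ) (2 * Real.pi)) := hK.prod isCompact_Icc
  obtain ⟨M, hM⟩ := hKc.exists_bound_of_continuousOn
    (contDiff_deriv_snd (f := fun x : P × ℝ => m x.1 x.2) hm).continuous.continuousOn
  -- Over `K` the speed has a positive lower bound `μ`, and `M` bounds `|∂_θ m|`.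
  obtain ⟨μ, hμ, hμ'⟩ := hKc.exists_forall_le'
    (contDiff_speed_family hc).continuous.continuousOn (a := 0) fun x _ => speed_pos _ _
  let δ : ℝ := μ / (|M| + 1)
  have hδ : 0 < δ := by positivity
  have hδM : δ * M < μ := by
    have h1 : δ * (|M| + 1) = μ := div_mul_cancel₀ _ (by positivity)
    nlinarith [le_abs_self M]
  -- A reparametrized `ε` with `χ'(0) = 1` but `|χ| ≤ δ`: since `δ * M < μ`, the perturbed loop is
  -- an immersion for every real `ε`, not only for small ones.
  let χ : ℝ → ℝ := fun ε => δ * Real.sin (ε / δ)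
  have hχδ : ∀ ε, |χ ε| ≤ δ := fun ε => by
    rw [abs_mul, abs_of_pos hδ]
    exact mul_le_of_le_one_right hδ.le (Real.abs_sin_le_one _)
  have himm : ∀ ε p θ, deriv ((c p).loop + χ ε • m p : Loop d).toFun θ ≠ 0 := by
    intro ε p θ
    have h1 : HasDerivAt ((c p).loop + χ ε • m p : Loop d).toFun
        (deriv (c p).loop.toFun θ + χ ε • deriv (m p).toFun θ) θ :=
      ((c p).loop.differentiable θ).hasDerivAt.add
        (((m p).differentiable θ).hasDerivAt.const_smul (χ ε))
    rw [h1.deriv]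
    by_cases hp : p ∈ K
    · obtain ⟨σ, hσ, h2, h3⟩ := exists_mem_Icc_deriv_eq (c p).loop (m p) θ
      rw [h2, h3]
      intro h4
      have h5 : ‖deriv (c p).loop.toFun σ‖ = |χ ε| * ‖deriv (m p).toFun σ‖ := by
        rw [eq_neg_of_add_eq_zero_left h4, norm_neg, norm_smul, Real.norm_eq_abs]
      have h6 : ‖deriv (m p).toFun σ‖ ≤ M := hM (p, σ) ⟨hp, hσ⟩
      have h7 : μ ≤ ‖deriv (c p).loop.toFun σ‖ := hμ' (p, σ) ⟨hp, hσ⟩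
      have h8 : |χ ε| * ‖deriv (m p).toFun σ‖ ≤ δ * M :=
        mul_le_mul (hχδ ε) h6 (norm_nonneg _) hδ.le
      linarith
    · have h2 : deriv (m p).toFun θ = 0 := by
        rw [hmK p hp]
        exact deriv_const θ 0
      rw [h2, smul_zero, add_zero]
      exact (c p).deriv_ne_zero θ
  refine ⟨χ, fun ε p => ⟨(c p).loop + χ ε • m p, himm ε p⟩, ?_, ?_, ?_, fun _ _ => rfl⟩
  · exact contDiff_const.mul (Real.contDiff_sin.comp (contDiff_id.div_const _))
  · simp [χ]
  · have h1 : HasDerivAt (fun ε : ℝ => Real.sin (ε / δ)) (Real.cos (0 / δ) * (1 / δ)) 0 :=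
      (Real.hasDerivAt_sin (0 / δ)).comp 0 ((hasDerivAt_id 0).div_const δ)
    refine (h1.const_mul δ).congr_deriv ?_
    rw [zero_div, Real.cos_zero, one_mul, mul_one_div_cancel hδ.ne']

theorem isSmoothFamily_variation {P : Type} [NormedAddCommGroup P] [NormedSpace ℝ P]
    {c m : P → Loop d} (hc : IsSmoothFamily c) (hm : IsSmoothFamily m) {χ : ℝ → ℝ}
    (hχ : ContDiff ℝ ∞ χ) : IsSmoothFamily fun x : ℝ × P => c x.2 + χ x.1 • m x.2 :=
  ContDiff.add (f := fun y : (ℝ × P) × ℝ => c y.1.2 y.2)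
    (g := fun y : (ℝ × P) × ℝ => χ y.1.1 • m y.1.2 y.2) (hc.comp contDiff_snd)
    ((hχ.comp (contDiff_fst.comp contDiff_fst)).smul (hm.comp contDiff_snd))

theorem hasDerivAt_variation (a b : Loop d) {χ : ℝ → ℝ} (hχ : HasDerivAt χ 1 0) (θ : ℝ) :
    HasDerivAt (fun ε => (a + χ ε • b) θ) (b θ) 0 := by
  have h := (hχ.smul_const (b θ)).const_add (a θ)
  rwa [one_smul] at h

theorem Imm.ext_loop {c₁ c₂ : Imm d} (h : c₁.loop = c₂.loop) : c₁ = c₂ := by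
  cases c₁
  cases c₂
  cases h
  rfl

/-- This is `exists_variation` over the one-point parameter space `Fin 0 → ℝ`, where the support
condition is vacuous. -/
theorem exists_curve (c : Imm d) (m : Loop d) :
    ∃ (γ : ℝ → Imm d) (hγ : IsSmoothFamily fun ε => (γ ε).loop),
      γ 0 = c ∧ pathVelocity γ hγ 0 = m := by
  have hc : IsSmoothFamily fun _ : Fin 0 → ℝ => c.loop := isSmoothFamily_const _
  have hm : IsSmoothFamily fun _ : Fin 0 → ℝ => m := isSmoothFamily_const _
  obtain ⟨χ, f, hχ, hχ0, hχ1, hf⟩ := exists_variation (c := fun _ => c) hc hm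
    (Set.finite_univ (α := Fin 0 → ℝ)).isCompact fun p hp => (hp (Set.mem_univ p)).elim
  have h1 : IsSmoothFamily fun ε => (f ε 0).loop := by
    simp only [hf]
    exact (isSmoothFamily_variation hc hm hχ).comp
      (f := fun ε : ℝ => (ε, (0 : Fin 0 → ℝ))) (contDiff_id.prodMk contDiff_const)
  refine ⟨fun ε => f ε 0, h1, ?_, ?_⟩
  · exact Imm.ext_loop (by rw [hf, hχ0, zero_smul, add_zero])
  · refine velocity_eq_of_hasDerivAt h1 fun θ => ?_
    simp only [hf]
    exact hasDerivAt_variation _ _ hχ1 θ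

/-! ### Directional derivatives -/

variable {A : ℝ → Loop d →L[ℝ] Loop d}

/-- The directional derivative `(D_{c,m} A_c) k`. -/
def opADeriv (hA : IsSmoothOperatorFamily A) (c : Imm d) (m k : Loop d) : Loop d :=
  velocity (fun ε => opA A ((exists_curve c m).choose ε) k)
    (isSmoothFamily_opA hA (exists_curve c m).choose_spec.choose (isSmoothFamily_const k)) 0

/-- `opADeriv` is computed along one chosen curve, but by `deriv_opA_path_congr` any curve with the
same position and velocity gives the same value. -/
theorem hasDerivAt_opA_opADeriv (hA : IsSmoothOperatorFamily A) {c : ℝ → Imm d}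
    (hc : IsSmoothFamily fun t => (c t).loop) (k : Loop d) (t θ : ℝ) :
    HasDerivAt (fun τ => opA A (c τ) k θ) (opADeriv hA (c t) (pathVelocity c hc t) k θ) t := by
  refine (hasDerivAt_opA_path hc hA k t θ).differentiableAt.hasDerivAt.congr_deriv ?_
  have h := (exists_curve (c t) (pathVelocity c hc t)).choose_spec.choose_spec
  exact deriv_opA_path_congr hA hc _ h.1.symm h.2.symm k θ

/-- The product rule for `A_c h`. -/
theorem hasDerivAt_opA (hA : IsSmoothOperatorFamily A) {c : ℝ → Imm d}
    (hc : IsSmoothFamily fun t => (c t).loop) {h : ℝ → Loop d} (hh : IsSmoothFamily h) (t θ : ℝ) :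
    HasDerivAt (fun τ => opA A (c τ) (h τ) θ)
      (opADeriv hA (c t) (pathVelocity c hc t) (h t) θ + opA A (c t) (velocity h hh t) θ) t := by
  have h1 : IsSmoothFamily fun x : ℝ × ℝ => opA A (c x.1) (h x.2) :=
    isSmoothFamily_opA hA (c := fun x : ℝ × ℝ => c x.1) (h := fun x : ℝ × ℝ => h x.2)
      (hc.comp contDiff_fst) (hh.comp contDiff_snd)
  have h2 := hasDerivAt_diagonal (f := fun x : ℝ × ℝ => opA A (c x.1) (h x.2) θ)
    (ContDiff.comp (g := fun x : (ℝ × ℝ) × ℝ => opA A (c x.1.1) (h x.1.2) x.2)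
      (f := fun p => (p, θ)) h1 (contDiff_id.prodMk contDiff_const)) t
  have h3 := (hasDerivAt_opA_opADeriv hA hc (h t) t θ).deriv
  have h4 := (hasDerivAt_opA_const A (c t) hh t θ).deriv
  simp only [h3, h4] at h2
  exact h2

theorem hasDirDeriv_opA (hA : IsSmoothOperatorFamily A) (c : Imm d) (m k : Loop d) :
    HasDirDeriv (fun c' => opA A c' k) c m (opADeriv hA c m k) := by
  rintro γ hγ rfl rfl
  have h1 : IsSmoothFamily fun ε => opA A (γ ε) k :=
    isSmoothFamily_opA hA hγ (isSmoothFamily_const k)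
  have h2 := tendsto_velocity h1 0
  rw [velocity_eq_of_hasDerivAt h1 (hasDerivAt_opA_opADeriv hA hγ k 0)] at h2
  simp only [zero_add] at h2
  exact h2

/-- Running the curve at `r` times its speed yields one factor `r`, linearity of `A_c` the other.
The argument includes `r = 0`. -/
theorem opADeriv_smul (hA : IsSmoothOperatorFamily A) (c : Imm d) (r : ℝ) (m k : Loop d) :
    opADeriv hA c (r • m) (r • k) = r ^ 2 • opADeriv hA c m k := by
  obtain ⟨γ, hγ, rfl, rfl⟩ := exists_curve c m
  have h1 : IsSmoothFamily fun ε => (γ (r * ε)).loop :=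
    hγ.comp (contDiff_const.mul contDiff_id)
  have h0 : HasDerivAt (fun ε : ℝ => r * ε) r 0 := by
    simpa using (hasDerivAt_id (0 : ℝ)).const_mul r
  have h2 : pathVelocity (fun ε => γ (r * ε)) h1 0 = r • pathVelocity γ hγ 0 := by
    refine velocity_eq_of_hasDerivAt h1 fun θ => ?_
    refine HasDerivAt.scomp (g₁ := fun ε => (γ ε).loop θ) 0 ?_ h0
    rw [mul_zero]
    exact hasDerivAt_velocity hγ 0 θ
  refine Loop.ext fun θ => ?_
  have h3 := hasDerivAt_opA_opADeriv hA h1 (r • k) 0 θ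
  simp only [h2, mul_zero, map_smul, Loop.smul_apply] at h3
  have h4 : HasDerivAt (fun ε => opA A (γ ε) k θ)
      (opADeriv hA (γ 0) (pathVelocity γ hγ 0) k θ) (r * 0) := by
    rw [mul_zero]
    exact hasDerivAt_opA_opADeriv hA hγ k 0 θ
  have h5 := (HasDerivAt.scomp (0 : ℝ) h4 h0).const_smul r
  rw [Loop.smul_apply, pow_two, mul_smul]
  exact h3.unique h5

/-- The directional derivative `D_{c,m} (G_c(h, k))`. -/
def metricDeriv (hA : IsSmoothOperatorFamily A) (c : Imm d) (m h k : Loop d) : ℝ :=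
  arcIntegral c fun θ => inner ℝ (opADeriv hA c m h θ) (k θ)
    + inner ℝ (arcDeriv c m θ) (tangent c θ) * inner ℝ (opA A c h θ) (k θ)

theorem continuous_inner_mul_speed (c : Imm d) (h k : Loop d) :
    Continuous fun θ => inner ℝ (h θ) (k θ) * speed c θ :=
  (h.contDiff.continuous.inner k.contDiff.continuous).mul (contDiff_speed c).continuous

theorem metric_add_left (c : Imm d) (h₁ h₂ k : Loop d) :
    metric A c (h₁ + h₂) k = metric A c h₁ k + metric A c h₂ k := by
  simp only [metric, arcIntegral, map_add, Loop.add_apply, inner_add_left, add_mul]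
  exact intervalIntegral.integral_add
    ((continuous_inner_mul_speed c _ _).intervalIntegrable _ _)
    ((continuous_inner_mul_speed c _ _).intervalIntegrable _ _)

theorem metric_smul_left (c : Imm d) (r : ℝ) (h k : Loop d) :
    metric A c (r • h) k = r * metric A c h k := by
  simp only [metric, arcIntegral, map_smul, Loop.smul_apply, real_inner_smul_left, mul_assoc]
  exact intervalIntegral.integral_const_mul _ _

theorem metric_zero_left (c : Imm d) (k : Loop d) : metric A c 0 k = 0 := by
  simpa using metric_smul_left (A := A) c 0 0 k

theorem metric_zero_right (c : Imm d) (h : Loop d) : metric A c h 0 = 0 := by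
  have h0 : ∀ θ, (0 : Loop d) θ = 0 := fun _ => rfl
  simp [metric, arcIntegral, h0]

/-- The product rule for `G_c(h, k)`. -/
theorem hasDerivAt_metric (hA : IsSmoothOperatorFamily A) {c : ℝ → Imm d}
    (hc : IsSmoothFamily fun t => (c t).loop) {h k : ℝ → Loop d} (hh : IsSmoothFamily h)
    (hk : IsSmoothFamily k) (t : ℝ) :
    HasDerivAt (fun τ => metric A (c τ) (h τ) (k τ))
      (metricDeriv hA (c t) (pathVelocity c hc t) (h t) (k t)
        + metric A (c t) (velocity h hh t) (k t) + metric A (c t) (h t) (velocity k hk t)) t := by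
  have h1 : ∀ θ, HasDerivAt
      (fun τ => inner ℝ (opA A (c τ) (h τ) θ) (k τ θ) * speed (c τ) θ)
      (((inner ℝ (opADeriv hA (c t) (pathVelocity c hc t) (h t) θ) (k t θ)
          + inner ℝ (arcDeriv (c t) (pathVelocity c hc t) θ) (tangent (c t) θ)
            * inner ℝ (opA A (c t) (h t) θ) (k t θ)) * speed (c t) θ
        + inner ℝ (opA A (c t) (velocity h hh t) θ) (k t θ) * speed (c t) θ)
        + inner ℝ (opA A (c t) (h t) θ) (velocity k hk t θ) * speed (c t) θ) t := fun θ => by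
    refine (((hasDerivAt_opA hA hc hh t θ).inner ℝ (hasDerivAt_velocity hk t θ)).mul
      (hasDerivAt_speed hc t θ)).congr_deriv ?_
    rw [stretch_eq, inner_add_left]
    ring
  have h2 := hasDerivAt_intervalIntegral (contDiff_metric_integrand hA hc hh hk) 0 (2 * Real.pi) t
  refine h2.congr_deriv ?_
  simp only [(h1 _).deriv]
  have h3 : Continuous fun θ => (inner ℝ (opADeriv hA (c t) (pathVelocity c hc t) (h t) θ) (k t θ)
          + inner ℝ (arcDeriv (c t) (pathVelocity c hc t) θ) (tangent (c t) θ)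
            * inner ℝ (opA A (c t) (h t) θ) (k t θ)) * speed (c t) θ :=
    (((Loop.contDiff _).continuous.inner (Loop.contDiff _).continuous).add
      (((contDiff_arcDeriv (c t) (Loop.contDiff _)).continuous.inner
        (contDiff_tangent _).continuous).mul
      ((Loop.contDiff _).continuous.inner (Loop.contDiff _).continuous))).mul
      (contDiff_speed _).continuous
  have h4 := continuous_inner_mul_speed (c t) (opA A (c t) (velocity h hh t)) (k t)
  have h5 := continuous_inner_mul_speed (c t) (opA A (c t) (h t)) (velocity k hk t)
  exact (intervalIntegral.integral_add ((h3.add h4).intervalIntegrable _ _)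
    (h5.intervalIntegrable _ _)).trans (congrArg (· + _)
      (intervalIntegral.integral_add (h3.intervalIntegrable _ _) (h4.intervalIntegrable _ _)))

theorem hasDerivAt_metric_path (hA : IsSmoothOperatorFamily A) {c : ℝ → Imm d}
    (hc : IsSmoothFamily fun t => (c t).loop) (h k : Loop d) (t : ℝ) :
    HasDerivAt (fun τ => metric A (c τ) h k)
      (metricDeriv hA (c t) (pathVelocity c hc t) h k) t := by
  have h1 := hasDerivAt_metric hA hc (isSmoothFamily_const h) (isSmoothFamily_const k) t
  have h2 : ∀ h : Loop d, velocity (fun _ => h) (isSmoothFamily_const h) t = 0 := fun h =>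
    velocity_eq_of_hasDerivAt _ fun θ => hasDerivAt_const t (h θ)
  simpa only [h2, metric_zero_left, metric_zero_right, add_zero] using h1

theorem hasDirDeriv_metric (hA : IsSmoothOperatorFamily A) (c : Imm d) (m h k : Loop d) :
    HasDirDeriv (fun c' => metric A c' h k) c m (metricDeriv hA c m h k) := by
  rintro γ hγ rfl rfl
  have h1 := hasDerivAt_iff_tendsto_inv_smul.1 (hasDerivAt_metric_path hA hγ h k 0)
  simp only [zero_add] at h1
  exact h1

/-! ### Consequences of the invariance under reparametrizations -/

theorem CircleDiff.ext_toFun {φ₁ φ₂ : CircleDiff} (h : φ₁.toFun = φ₂.toFun) : φ₁ = φ₂ := by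
  cases φ₁
  cases φ₂
  cases h
  rfl

theorem CircleDiff.hasDerivAt (φ : CircleDiff) (θ : ℝ) : HasDerivAt φ (deriv φ θ) θ :=
  (φ.smooth.differentiable (by simp) θ).hasDerivAt

theorem CircleDiff.hasDerivAt_symm (φ : CircleDiff) (y : ℝ) :
    HasDerivAt φ.symm (deriv φ (φ.symm y))⁻¹ y :=
  (φ.hasDerivAt _).of_local_left_inverse φ.homeomorph.symm.continuous.continuousAt
    (φ.deriv_pos _).ne' (Filter.Eventually.of_forall fun z => φ.apply_symm_apply z)

theorem deriv_psi (c : Imm d) (θ : ℝ) : deriv (psi c) θ = 2 * Real.pi / len c * speed c θ :=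
  (hasDerivAt_psi c θ).deriv

/-- The metric at `c` depends on the speed of `c` only. -/
theorem metric_congr {c₁ c₂ : Imm d} (h : speed c₁ = speed c₂) : metric A c₁ = metric A c₂ := by
  have h1 : len c₁ = len c₂ := by rw [len, h, len]
  have h2 : psi c₁ = psi c₂ := CircleDiff.ext_toFun (by
    funext θ
    change 2 * Real.pi / len c₁ * _ = 2 * Real.pi / len c₂ * _
    rw [h1, h])
  funext k₁ k₂
  simp only [metric, arcIntegral, opA, h, h1, h2]

theorem speed_reparam (c : Imm d) (φ : CircleDiff) (θ : ℝ) :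
    speed (c.reparam φ) θ = deriv φ θ * speed c (φ θ) := by
  have h : HasDerivAt (c.reparam φ).loop (deriv φ θ • deriv c.loop (φ θ)) θ :=
    HasDerivAt.scomp (h := φ) θ (c.loop.differentiable (φ θ)).hasDerivAt (φ.hasDerivAt θ)
  rw [speed, h.deriv, norm_smul, Real.norm_of_nonneg (φ.deriv_pos θ).le, speed]

/-! ### Shifts along arc length and the periodicity of `w`. -/

theorem hasDerivAt_arcShift (c : Imm d) (a θ : ℝ) :
    HasDerivAt (fun θ => (psi c).symm (psi c θ + a))
      (speed c θ / speed c ((psi c).symm (psi c θ + a))) θ := by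
  refine (((psi c).hasDerivAt_symm (psi c θ + a)).comp θ
    (((psi c).hasDerivAt θ).add_const a)).congr_deriv ?_
  rw [deriv_psi, deriv_psi]
  have h1 := (speed_pos c ((psi c).symm (psi c θ + a))).ne'
  have h2 := (len_pos c).ne'
  field_simp

/-- The diffeomorphism that moves every point of the curve `c` by the same arc length. -/
def arcShift (c : Imm d) (a : ℝ) : CircleDiff where
  toFun θ := (psi c).symm (psi c θ + a)
  smooth := (psi c).symm.smooth.comp ((psi c).smooth.add contDiff_const)
  deriv_pos θ := by
    rw [(hasDerivAt_arcShift c a θ).deriv]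
    exact div_pos (speed_pos _ _) (speed_pos _ _)
  add_period θ := by
    rw [(psi c).add_period, add_right_comm, (psi c).symm.add_period]

theorem speed_reparam_arcShift (c : Imm d) (a : ℝ) :
    speed (c.reparam (arcShift c a)) = speed c := by
  funext θ
  rw [speed_reparam]
  change deriv (fun θ => (psi c).symm (psi c θ + a)) θ
    * speed c ((psi c).symm (psi c θ + a)) = speed c θ
  rw [(hasDerivAt_arcShift c a θ).deriv, div_mul_cancel₀ _ (speed_pos _ _).ne']

theorem isSmoothFamily_arcShift (c : Imm d) (h : Loop d) :
    IsSmoothFamily fun a => reparam (arcShift c a) h :=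
  isSmoothFamily_reparam (φ := arcShift c) ((psi c).symm.smooth.comp
    (((psi c).smooth.comp contDiff_snd).add contDiff_fst)) (isSmoothFamily_const h)

theorem velocity_arcShift (c : Imm d) (h : Loop d) (θ : ℝ) :
    velocity (fun a => reparam (arcShift c a) h) (isSmoothFamily_arcShift c h) 0 θ
      = (len c / (2 * Real.pi)) • arcDeriv c h θ := by
  refine HasDerivAt.deriv ?_
  have h1 : HasDerivAt (fun a : ℝ => psi c θ + a) 1 0 := (hasDerivAt_id 0).const_add _
  have h2 : HasDerivAt (fun a => (psi c).symm (psi c θ + a)) (deriv (psi c) θ)⁻¹ 0 := by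
    have h3 := ((psi c).hasDerivAt_symm (psi c θ + 0)).comp 0 h1
    rwa [add_zero, CircleDiff.symm_apply_apply, mul_one] at h3
  have h4 : HasDerivAt h (deriv h θ) ((psi c).symm (psi c θ + 0)) := by
    rw [add_zero, CircleDiff.symm_apply_apply]
    exact (h.differentiable θ).hasDerivAt
  refine (HasDerivAt.scomp (0 : ℝ) h4 h2).congr_deriv ?_
  rw [arcDeriv, smul_smul, deriv_psi, mul_inv, inv_div]

/-- The product rule for a fixed inner product `G_c`. -/
theorem hasDerivAt_metric_const (hA : IsSmoothOperatorFamily A) (c : Imm d) {h k : ℝ → Loop d}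
    (hh : IsSmoothFamily h) (hk : IsSmoothFamily k) (t : ℝ) :
    HasDerivAt (fun τ => metric A c (h τ) (k τ))
      (metric A c (velocity h hh t) (k t) + metric A c (h t) (velocity k hk t)) t := by
  have hc : IsSmoothFamily fun _ : ℝ => (c : Imm d).loop := isSmoothFamily_const _
  have h1 := hasDerivAt_metric hA (c := fun _ => c) hc hh hk t
  have h2 := (hasDerivAt_metric_path hA (c := fun _ => c) hc (h t) (k t) t).unique
    (hasDerivAt_const t _)
  rwa [h2, zero_add] at h1

theorem continuous_wTerm_integrand (c : Imm d) (h : Loop d) :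
    Continuous fun σ => inner ℝ (opA A c h σ) (arcDeriv c h σ) * speed c σ :=
  ((Loop.contDiff _).continuous.inner (contDiff_arcDeriv c h.contDiff).continuous).mul
    (contDiff_speed c).continuous

theorem hasDerivAt_wTerm (c : Imm d) (h : Loop d) (θ : ℝ) :
    HasDerivAt (wTerm A c h) (inner ℝ (opA A c h θ) (arcDeriv c h θ) * speed c θ) θ :=
  ((continuous_wTerm_integrand c h).integral_hasStrictDerivAt 0 θ).hasDerivAt

theorem wTerm_zero (c : Imm d) (h : Loop d) : wTerm A c h 0 = 0 := intervalIntegral.integral_same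

/-- Arc length shifts leave the speed of `c`, hence `G_c`, unchanged, so invariance makes `G_c(h ∘
σ_a, h ∘ σ_a)` constant in `a`. Its derivative at `a = 0` is, by symmetry, `2 (ℓ_c / 2π) ∫ ⟨A_c h,
D_s h⟩ ds`. -/
theorem wTerm_two_pi (hA : IsSmoothOperatorFamily A) (hG : IsWeakRiemannianMetric (metric A))
    (hinv : IsReparamInvariant (metric A)) (c : Imm d) (h : Loop d) :
    wTerm A c h (2 * Real.pi) = 0 := by
  have h1 : ∀ a, metric A c (reparam (arcShift c a) h) (reparam (arcShift c a) h)
      = metric A c h h := fun a => by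
    rw [← hinv (arcShift c a) c h h, metric_congr (speed_reparam_arcShift c a)]
  have h2 := hasDerivAt_metric_const hA c (isSmoothFamily_arcShift c h)
    (isSmoothFamily_arcShift c h) 0
  simp only [h1] at h2
  have h3 := h2.unique (hasDerivAt_const 0 _)
  have h4 : reparam (arcShift c 0) h = h := Loop.ext fun θ => by
    change h ((psi c).symm (psi c θ + 0)) = h θ
    rw [add_zero, CircleDiff.symm_apply_apply]
  rw [hG.symm c (velocity _ _ _), ← two_mul, h4] at h3
  have h5 := (mul_eq_zero.1 h3).resolve_left two_ne_zero
  simp only [metric, arcIntegral, velocity_arcShift, real_inner_smul_right, mul_assoc] at h5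
  rw [intervalIntegral.integral_const_mul] at h5
  refine (mul_eq_zero.1 h5).resolve_left (div_pos (len_pos c) (by positivity)).ne'

theorem periodic_arcDeriv (c : Imm d) {f : ℝ → Vec d} (hf : Function.Periodic f (2 * Real.pi)) :
    Function.Periodic (arcDeriv c f) (2 * Real.pi) := fun θ => by
  rw [arcDeriv, arcDeriv, speed_periodic c θ, ← deriv_comp_add_const]
  simp only [hf _]

theorem periodic_tangent (c : Imm d) : Function.Periodic (tangent c) (2 * Real.pi) :=
  periodic_arcDeriv c c.loop.periodic

theorem periodic_wTerm (hA : IsSmoothOperatorFamily A) (hG : IsWeakRiemannianMetric (metric A))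
    (hinv : IsReparamInvariant (metric A)) (c : Imm d) (h : Loop d) :
    Function.Periodic (wTerm A c h) (2 * Real.pi) := fun θ => by
  have hc := continuous_wTerm_integrand (A := A) c h
  have hp : Function.Periodic (fun σ => inner ℝ (opA A c h σ) (arcDeriv c h σ) * speed c σ)
      (2 * Real.pi) := fun σ => by
    simp only [Loop.periodic, periodic_arcDeriv c h.periodic σ, speed_periodic c σ]
  have h1 : (∫ σ in θ..(θ + 2 * Real.pi), inner ℝ (opA A c h σ) (arcDeriv c h σ) * speed c σ)
      = 0 := by
    rw [hp.intervalIntegral_add_eq θ 0, zero_add]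
    exact wTerm_two_pi hA hG hinv c h
  rw [wTerm, ← intervalIntegral.integral_add_adjacent_intervals (hc.intervalIntegrable 0 θ)
    (hc.intervalIntegrable θ (θ + 2 * Real.pi)), h1, add_zero, wTerm]

theorem contDiff_wTerm (c : Imm d) (h : Loop d) : ContDiff ℝ ∞ (wTerm A c h) := by
  rw [contDiff_infty_iff_deriv]
  refine ⟨fun θ => (hasDerivAt_wTerm c h θ).differentiableAt, ?_⟩
  rw [show deriv (wTerm A c h) = fun θ => inner ℝ (opA A c h θ) (arcDeriv c h θ) * speed c θ from
    funext fun θ => (hasDerivAt_wTerm c h θ).deriv]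
  exact (ContDiff.inner ℝ (Loop.contDiff _) (contDiff_arcDeriv c h.contDiff)).mul
    (contDiff_speed c)

/-- The terms of the geodesic equation that come from the variation of the arc length
parametrization. -/
def lengthForce (A : ℝ → Loop d →L[ℝ] Loop d) (c : Imm d) (h : Loop d) (θ : ℝ) : Vec d :=
  inner ℝ (opA A c h θ) (arcDeriv c h θ) • tangent c θ
    + (wTerm A c h θ + wZero A c h) • arcDeriv c (tangent c) θ

theorem contDiff_lengthForce (c : Imm d) (h : Loop d) : ContDiff ℝ ∞ (lengthForce A c h) := by
  have h1 : ContDiff ℝ ∞ fun θ => inner ℝ (opA A c h θ) (arcDeriv c h θ) :=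
    ContDiff.inner ℝ (opA A c h).contDiff (contDiff_arcDeriv c h.contDiff)
  have h2 : ContDiff ℝ ∞ fun θ => wTerm A c h θ + wZero A c h :=
    (contDiff_wTerm c h).add contDiff_const
  exact (h1.smul (contDiff_tangent c)).add (h2.smul (contDiff_arcDeriv c (contDiff_tangent c)))

theorem geodesicTerm_eq (c : Imm d) (h : Loop d) (θ : ℝ) :
    geodesicTerm A c h θ
      = inner ℝ (arcDeriv c h θ) (tangent c θ) • opA A c h θ + lengthForce A c h θ :=
  add_assoc _ _ _

theorem contDiff_geodesicTerm (c : Imm d) (h : Loop d) : ContDiff ℝ ∞ (geodesicTerm A c h) := by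
  rw [funext (geodesicTerm_eq c h)]
  have h1 : ContDiff ℝ ∞ fun θ => inner ℝ (arcDeriv c h θ) (tangent c θ) :=
    ContDiff.inner ℝ (contDiff_arcDeriv c h.contDiff) (contDiff_tangent c)
  exact (h1.smul (opA A c h).contDiff).add (contDiff_lengthForce c h)

theorem periodic_geodesicTerm (hA : IsSmoothOperatorFamily A)
    (hG : IsWeakRiemannianMetric (metric A)) (hinv : IsReparamInvariant (metric A))
    (c : Imm d) (h : Loop d) : Function.Periodic (geodesicTerm A c h) (2 * Real.pi) := fun θ => by
  simp only [geodesicTerm, Loop.periodic, periodic_arcDeriv c h.periodic θ, periodic_tangent c θ,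
    periodic_arcDeriv c (periodic_tangent c) θ, periodic_wTerm hA hG hinv c h θ]

/-! ### The derivative of `G_c(h, h)` -/

/-- `opA'` is defined pointwise; knowing that the `λ`-derivative is again a loop supplies the
continuity needed to split integrals. With `λ = exp x`, the chain rule factor `ℓ_c` is divided out.
-/
theorem exists_loop_opA' (hA : IsSmoothOperatorFamily A) (c : Imm d) (h : Loop d) :
    ∃ k : Loop d, ∀ y, deriv (fun l => A l (reparam (psi c).symm h) y) (len c) = k y := by
  have hl := len_pos c
  have h1 := hA ℝ Real.exp _ Real.contDiff_exp Real.exp_pos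
    (isSmoothFamily_const (reparam (psi c).symm h))
  refine ⟨(len c)⁻¹ • velocity _ h1 (Real.log (len c)), fun y => ?_⟩
  have h2 : HasDerivAt (fun x => A (Real.exp x) (reparam (psi c).symm h) y)
      (len c • deriv (fun l => A l (reparam (psi c).symm h) y) (len c)) (Real.log (len c)) := by
    have h3 := Real.hasDerivAt_exp (Real.log (len c))
    have h4 := (differentiableAt_operator hA (reparam (psi c).symm h) y hl).hasDerivAt
    rw [Real.exp_log hl] at h3
    refine HasDerivAt.scomp (g₁ := fun l => A l (reparam (psi c).symm h) y)
      (Real.log (len c)) ?_ h3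
    rwa [Real.exp_log hl]
  rw [Loop.smul_apply, (hasDerivAt_velocity h1 (Real.log (len c)) y).unique h2,
    inv_smul_smul₀ hl.ne']

/-! ### Passage to the arc length variable `y = ψ_c(θ)`. -/

theorem psi_zero (c : Imm d) : psi c 0 = 0 := by
  change 2 * Real.pi / len c * ∫ σ in (0 : ℝ)..0, speed c σ = 0
  rw [intervalIntegral.integral_same, mul_zero]

theorem arcIntegral_comp_psi (c : Imm d) {F : ℝ → ℝ} (hF : Continuous F) :
    arcIntegral c (fun θ => F (psi c θ))
      = len c / (2 * Real.pi) * ∫ y in (0 : ℝ)..(2 * Real.pi), F y := by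
  have h1 := intervalIntegral.integral_comp_mul_deriv (a := 0) (b := 2 * Real.pi)
    (fun θ _ => hasDerivAt_psi c θ)
    (continuous_const.mul (contDiff_speed c).continuous).continuousOn hF
  have h2 : psi c (2 * Real.pi) = 2 * Real.pi := by
    have := (psi c).add_period 0
    rwa [psi_zero, zero_add] at this
  change (∫ θ in (0 : ℝ)..(2 * Real.pi), F (psi c θ) * (2 * Real.pi / len c * speed c θ))
    = ∫ y in psi c 0..psi c (2 * Real.pi), F y at h1
  rw [psi_zero, h2] at h1
  rw [← h1, arcIntegral, ← intervalIntegral.integral_const_mul]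
  refine intervalIntegral.integral_congr fun θ _ => ?_
  have := (len_pos c).ne'
  have := Real.pi_ne_zero
  field_simp

/-- In this form the outer `ψ_c` has been absorbed by the change of variables, so differentiating in
`c` never produces a `θ`-derivative of `A_c h`. -/
theorem metric_eq_integral (c : Imm d) (h k : Loop d) :
    metric A c h k = len c / (2 * Real.pi) * ∫ y in (0 : ℝ)..(2 * Real.pi),
      inner ℝ (A (len c) (reparam (psi c).symm h) y) (reparam (psi c).symm k y) := by
  rw [← arcIntegral_comp_psi c
    ((Loop.contDiff _).continuous.inner (Loop.contDiff _).continuous), metric]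
  refine congrArg (arcIntegral c) (funext fun θ => ?_)
  rw [reparam_apply (psi c).symm k, CircleDiff.symm_apply_apply]
  rfl

theorem arcIntegral_add (c : Imm d) {f g : ℝ → ℝ} (hf : Continuous f) (hg : Continuous g) :
    arcIntegral c (fun θ => f θ + g θ) = arcIntegral c f + arcIntegral c g := by
  have hs := (contDiff_speed c).continuous
  simp only [arcIntegral, add_mul]
  exact intervalIntegral.integral_add ((hf.mul hs).intervalIntegrable _ _)
    ((hg.mul hs).intervalIntegrable _ _)

theorem arcIntegral_const_mul (c : Imm d) (r : ℝ) (f : ℝ → ℝ) :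
    arcIntegral c (fun θ => r * f θ) = r * arcIntegral c f := by
  simp only [arcIntegral, mul_assoc]
  exact intervalIntegral.integral_const_mul _ _

/-- The prefactor `ℓ_c / 2π` gives `ℓ_c⁻¹ G_c(h, h)`, the argument of `A(ℓ_c)` gives `A_c'`, and the
two factors `h ∘ ψ_c⁻¹` give equal contributions by symmetry, whence the `2`. -/
theorem metricDeriv_self_eq_arcIntegral (hA : IsSmoothOperatorFamily A)
    (hG : IsWeakRiemannianMetric (metric A)) (c : Imm d) (m h : Loop d) :
    metricDeriv hA c m h h
      = (∫ σ in (0 : ℝ)..(2 * Real.pi), stretch c m σ) * ((len c)⁻¹ * metric A c h h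
          + arcIntegral c fun θ => inner ℝ (opA' A c h θ) (h θ))
        - 2 * arcIntegral c fun θ => len c / (2 * Real.pi) * psiDeriv c m θ
            * inner ℝ (opA A c h θ) (arcDeriv c h θ) := by
  obtain ⟨γ, hγ, rfl, rfl⟩ := exists_curve c m
  have h1 : IsSmoothFamily fun τ => reparam (psi (γ τ)).symm h :=
    isSmoothFamily_reparam_psi_symm hγ (isSmoothFamily_const h)
  have h2 : IsSmoothFamily fun τ => A (len (γ τ)) (reparam (psi (γ τ)).symm h) :=
    hA ℝ (fun τ => len (γ τ)) _ (contDiff_len_family hγ) (fun _ => len_pos _) h1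
  obtain ⟨k, hk⟩ := exists_loop_opA' hA (γ 0) h
  set L := ∫ σ in (0 : ℝ)..(2 * Real.pi), stretch (γ 0) (pathVelocity γ hγ 0) σ
  set B := velocity _ h1 0 with hB
  set h' := reparam (psi (γ 0)).symm h with hh'
  have h3 : ∀ y, HasDerivAt (fun τ => inner ℝ (A (len (γ τ)) (reparam (psi (γ τ)).symm h) y)
      (reparam (psi (γ τ)).symm h y))
      (inner ℝ (A (len (γ 0)) h' y) (B y) + inner ℝ (L • k y + A (len (γ 0)) B y) (h' y)) 0 := by
    intro y
    have h4 := hasDerivAt_operator hA (contDiff_len_family hγ) (fun _ => len_pos _) h1 0 y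
    rw [(hasDerivAt_len hγ 0).deriv, hk] at h4
    exact h4.inner ℝ (hasDerivAt_velocity h1 0 y)
  have h5 := hasDerivAt_intervalIntegral (f := fun x : ℝ × ℝ =>
    inner ℝ (A (len (γ x.1)) (reparam (psi (γ x.1)).symm h) x.2)
      (reparam (psi (γ x.1)).symm h x.2)) (ContDiff.inner ℝ h2 h1) 0 (2 * Real.pi) 0
  simp only [(h3 _).deriv] at h5
  have h6 := ((hasDerivAt_len hγ 0).div_const (2 * Real.pi)).mul h5
  have h7 : HasDerivAt (fun τ => metric A (γ τ) h h) _ 0 :=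
    h6.congr_of_eventuallyEq (Filter.Eventually.of_forall fun τ => metric_eq_integral _ _ _)
  rw [(hasDerivAt_metric_path hA hγ h h 0).unique h7]
  have hcont : ∀ a b : Loop d, Continuous fun θ => inner ℝ (a θ) (b θ) := fun a b =>
    a.contDiff.continuous.inner b.contDiff.continuous
  rw [← arcIntegral_comp_psi (γ 0) (F := fun y => inner ℝ (A (len (γ 0)) h' y) (B y)
    + inner ℝ (L • k y + A (len (γ 0)) B y) (h' y)) ((hcont _ _).add
      (hcont (L • k + A (len (γ 0)) B) h'))]
  have h8 : (fun θ => inner ℝ (A (len (γ 0)) h' (psi (γ 0) θ)) (B (psi (γ 0) θ))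
      + inner ℝ (L • k (psi (γ 0) θ) + A (len (γ 0)) B (psi (γ 0) θ)) (h' (psi (γ 0) θ)))
      = fun θ => (inner ℝ (opA A (γ 0) h θ) (reparam (psi (γ 0)) B θ)
        + inner ℝ (opA A (γ 0) (reparam (psi (γ 0)) B) θ) (h θ))
        + L * inner ℝ (reparam (psi (γ 0)) k θ) (h θ) := by
    funext θ
    have h9 : h' (psi (γ 0) θ) = h θ := by
      rw [hh', reparam_apply, CircleDiff.symm_apply_apply]
    have h10 : A (len (γ 0)) B (psi (γ 0) θ) = opA A (γ 0) (reparam (psi (γ 0)) B) θ := by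
      change _ = A (len (γ 0)) (reparam (psi (γ 0)).symm (reparam (psi (γ 0)) B)) (psi (γ 0) θ)
      rw [reparam_symm_reparam]
    rw [h9, h10, inner_add_left, real_inner_smul_left, add_assoc, add_comm (L * _)]
    rfl
  have h11 : metric A (γ 0) h (reparam (psi (γ 0)) B)
      = -arcIntegral (γ 0) fun θ => len (γ 0) / (2 * Real.pi)
          * psiDeriv (γ 0) (pathVelocity γ hγ 0) θ
          * inner ℝ (opA A (γ 0) h θ) (arcDeriv (γ 0) h θ) := by
    rw [← neg_one_mul, ← arcIntegral_const_mul, metric]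
    refine congrArg (arcIntegral (γ 0)) (funext fun θ => ?_)
    rw [reparam_apply, hB, velocity_reparam_psi_symm hγ, arcDeriv, real_inner_smul_right,
      real_inner_smul_right, deriv_psi]
    have := (len_pos (γ 0)).ne'
    have := (speed_pos (γ 0) θ).ne'
    have := Real.pi_ne_zero
    field_simp
  have h12 : (fun θ => inner ℝ (reparam (psi (γ 0)) k θ) (h θ))
      = fun θ => inner ℝ (opA' A (γ 0) h θ) (h θ) := funext fun θ => by
    rw [reparam_apply, ← hk]
    rfl
  have h13 := (arcIntegral_add (γ 0) ((hcont (opA A (γ 0) h) (reparam (psi (γ 0)) B)).add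
    (hcont (opA A (γ 0) (reparam (psi (γ 0)) B)) h))
    ((hcont (reparam (psi (γ 0)) k) h).const_mul L)).trans (congrArg (· + _)
      (arcIntegral_add (γ 0) (hcont _ _) (hcont _ _)))
  rw [arcIntegral_const_mul, h12] at h13
  rw [h8]
  refine (congrArg (_ + ·) h13).trans ?_
  change _ + ((metric A (γ 0) h (reparam (psi (γ 0)) B)
    + metric A (γ 0) (reparam (psi (γ 0)) B) h) + _) = _
  rw [hG.symm (γ 0) (reparam _ B), h11, metric_eq_integral (γ 0) h h]
  have := (len_pos (γ 0)).ne'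
  field_simp
  ring

/-- Here `(ℓ_c / 2π) ψ̇ = Y - (L / 2π) ψ_c`, where `Y` is the primitive of the stretch and `L =
Y(2π)`. Integrating `Y` by parts against `w'` produces `w`; all remaining terms are multiples of
`L`, and their coefficient is `2 w₀`. -/
theorem metricDeriv_self (hA : IsSmoothOperatorFamily A)
    (hG : IsWeakRiemannianMetric (metric A)) (hinv : IsReparamInvariant (metric A))
    (c : Imm d) (m h : Loop d) :
    metricDeriv hA c m h h
      = 2 * ∫ θ in (0 : ℝ)..(2 * Real.pi), (wTerm A c h θ + wZero A c h) * stretch c m θ := by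
  have hst := (contDiff_stretch c m).continuous
  have hsp := (contDiff_speed c).continuous
  have hψ := (psi c).smooth.continuous
  have hℓ := (len_pos c).ne'
  have hw := (contDiff_wTerm (A := A) c h).continuous
  set L := ∫ σ in (0 : ℝ)..(2 * Real.pi), stretch c m σ
  set I : ℝ → ℝ := fun θ => inner ℝ (opA A c h θ) (arcDeriv c h θ) with hI
  have hIc : Continuous I :=
    (Loop.contDiff _).continuous.inner (contDiff_arcDeriv c h.contDiff).continuous
  set Y : ℝ → ℝ := fun θ => ∫ σ in (0 : ℝ)..θ, stretch c m σ with hY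
  have hYd : ∀ θ, HasDerivAt Y (stretch c m θ) θ := fun θ =>
    (hst.integral_hasStrictDerivAt 0 θ).hasDerivAt
  have hYc : Continuous Y := continuous_iff_continuousAt.2 fun θ => (hYd θ).continuousAt
  obtain ⟨k, hk⟩ := exists_loop_opA' hA c h
  have hk' : ∀ θ, opA' A c h θ = reparam (psi c) k θ := fun θ => hk (psi c θ)
  have hcont : ∀ a b : Loop d, Continuous fun θ => inner ℝ (a θ) (b θ) := fun a b =>
    a.contDiff.continuous.inner b.contDiff.continuous
  -- No boundary terms arise, since `w` vanishes at both `0` and `2π`.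
  have h1 : arcIntegral c (fun θ => Y θ * I θ)
      = -∫ θ in (0 : ℝ)..(2 * Real.pi), wTerm A c h θ * stretch c m θ := by
    have h2 := intervalIntegral.integral_mul_deriv_eq_deriv_mul (a := 0) (b := 2 * Real.pi)
      (fun θ _ => hYd θ) (fun θ _ => hasDerivAt_wTerm (A := A) c h θ)
      (hst.intervalIntegrable _ _) ((hIc.mul hsp).intervalIntegrable _ _)
    rw [wTerm_two_pi hA hG hinv, wTerm_zero, mul_zero, mul_zero, sub_zero, zero_sub] at h2
    simp only [mul_comm (wTerm A c h _), ← h2, arcIntegral, hI, mul_assoc]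
  have h3 : (arcIntegral c fun θ => len c / (2 * Real.pi) * psiDeriv c m θ * I θ)
      = arcIntegral c (fun θ => Y θ * I θ)
        - L / (2 * Real.pi) * arcIntegral c (fun θ => psi c θ * I θ) := by
    have h4 : (fun θ => len c / (2 * Real.pi) * psiDeriv c m θ * I θ)
        = fun θ => Y θ * I θ + -(L / (2 * Real.pi)) * (psi c θ * I θ) := by
      funext θ
      have h5 : psiDeriv c m θ = 2 * Real.pi / len c * Y θ - L / len c * psi c θ := rfl
      have := Real.pi_ne_zero
      rw [h5]
      field_simp
      ring
    have h6 := arcIntegral_add c (hYc.mul hIc) ((hψ.mul hIc).const_mul (-(L / (2 * Real.pi))))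
    rw [h4]
    refine h6.trans ?_
    rw [arcIntegral_const_mul, neg_mul, ← sub_eq_add_neg]
    rfl
  have h6 : wZero A c h = 1 / (2 * Real.pi) * arcIntegral c (fun θ => psi c θ * I θ)
      + 1 / 2 * ((len c)⁻¹ * metric A c h h
        + arcIntegral c fun θ => inner ℝ (opA' A c h θ) (h θ)) := by
    simp only [hk']
    have h8 := (hcont (opA A c h) h).const_mul (len c)⁻¹
    have h9 := hcont (reparam (psi c) k) h
    have h10 := arcIntegral_add c h8 h9
    have h11 := arcIntegral_add c ((hψ.mul hIc).const_mul (1 / (2 * Real.pi)))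
      ((h8.add h9).const_mul (1 / 2))
    rw [arcIntegral_const_mul] at h10
    rw [arcIntegral_const_mul, arcIntegral_const_mul] at h11
    refine Eq.trans ?_ (h11.trans (congrArg (fun x => _ + 1 / 2 * x) h10))
    refine congrArg (arcIntegral c) (funext fun θ => ?_)
    rw [real_inner_smul_right, inner_add_left, real_inner_smul_left, hk']
    rfl
  have h7 : (∫ θ in (0 : ℝ)..(2 * Real.pi), (wTerm A c h θ + wZero A c h) * stretch c m θ)
      = (∫ θ in (0 : ℝ)..(2 * Real.pi), wTerm A c h θ * stretch c m θ) + wZero A c h * L := by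
    simp only [add_mul]
    have h8 := intervalIntegral.integral_add (μ := MeasureTheory.volume)
      ((hw.mul hst).intervalIntegrable 0 (2 * Real.pi))
      ((hst.const_mul (wZero A c h)).intervalIntegrable 0 (2 * Real.pi))
    rw [intervalIntegral.integral_const_mul] at h8
    exact h8
  rw [metricDeriv_self_eq_arcIntegral hA hG, h3, h1, h7, h6]
  ring

/-- Integration by parts against the tangential derivative. -/
theorem integral_wTerm_mul_stretch (hA : IsSmoothOperatorFamily A)
    (hG : IsWeakRiemannianMetric (metric A)) (hinv : IsReparamInvariant (metric A))
    (c : Imm d) (m h : Loop d) :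
    (∫ θ in (0 : ℝ)..(2 * Real.pi), (wTerm A c h θ + wZero A c h) * stretch c m θ)
      = -arcIntegral c fun θ => inner ℝ (lengthForce A c h θ) (m θ) := by
  -- The difference of the two sides of the claim is the integral of the derivative of the periodic
  -- function `(w + w₀) ⟨m, v⟩`, hence zero.
  have h1 : ∀ θ, HasDerivAt
      (fun θ => (wTerm A c h θ + wZero A c h) * inner ℝ (m θ) (tangent c θ))
      ((wTerm A c h θ + wZero A c h) * stretch c m θ
        + inner ℝ (lengthForce A c h θ) (m θ) * speed c θ) θ := by
    intro θ
    have h2 : HasDerivAt (tangent c) (deriv (tangent c) θ) θ :=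
      ((contDiff_tangent c).differentiable (by simp) θ).hasDerivAt
    have h3 : deriv (tangent c) θ = speed c θ • arcDeriv c (tangent c) θ := by
      rw [arcDeriv, smul_inv_smul₀ (speed_pos c θ).ne']
    rw [h3] at h2
    refine (((hasDerivAt_wTerm c h θ).add_const _).mul
      ((m.differentiable θ).hasDerivAt.inner ℝ h2)).congr_deriv ?_
    rw [lengthForce, inner_add_left, real_inner_smul_left, real_inner_smul_left,
      real_inner_smul_right,
      real_inner_comm (m θ) (tangent c θ), real_inner_comm (m θ) (arcDeriv c (tangent c) θ),
      stretch]
    ring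
  have h4 : Continuous fun θ => (wTerm A c h θ + wZero A c h) * stretch c m θ :=
    ((contDiff_wTerm c h).continuous.add continuous_const).mul (contDiff_stretch c m).continuous
  have h5 : Continuous fun θ => inner ℝ (lengthForce A c h θ) (m θ) * speed c θ :=
    ((contDiff_lengthForce c h).continuous.inner m.contDiff.continuous).mul
      (contDiff_speed c).continuous
  have h6 := intervalIntegral.integral_eq_sub_of_hasDerivAt (a := 0) (b := 2 * Real.pi)
    (fun θ _ => h1 θ) ((h4.add h5).intervalIntegrable _ _)
  have h7 := intervalIntegral.integral_add (μ := MeasureTheory.volume)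
    (h4.intervalIntegrable 0 (2 * Real.pi)) (h5.intervalIntegrable 0 (2 * Real.pi))
  have h8 := m.periodic 0
  have h9 := periodic_tangent c 0
  have h10 := periodic_wTerm hA hG hinv c h 0
  rw [zero_add] at h8 h9 h10
  rw [h8, h9, h10, sub_self] at h6
  exact eq_neg_of_add_eq_zero_left (h7.symm.trans h6)

/-! ### The geodesic spray -/

/-- The loop `(D_{c,h} A_c) h + ⟨D_s h, v⟩ A_c h + ⟨A_c h, D_s h⟩ v + (w + w₀) D_s v`. -/
def sprayTerm (hA : IsSmoothOperatorFamily A) (hG : IsWeakRiemannianMetric (metric A))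
    (hinv : IsReparamInvariant (metric A)) (c : Imm d) (h : Loop d) : Loop d :=
  opADeriv hA c h h + Loop.mk (geodesicTerm A c h) (contDiff_geodesicTerm c h)
    fun θ => periodic_geodesicTerm hA hG hinv c h θ

/-- Paired with `k`, the length terms of `-sprayTerm` give `½ D_{c,k} G_c(h, h)` after the two
integrations by parts, and the other two terms are the integrand of `-D_{c,h} G_c(h, k)`. -/
theorem metric_eq_of_opA_eq_neg_sprayTerm (hA : IsSmoothOperatorFamily A)
    (hG : IsWeakRiemannianMetric (metric A))
    (hinv : IsReparamInvariant (metric A)) {c : Imm d} {h S : Loop d}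
    (hS : opA A c S = -sprayTerm hA hG hinv c h) (k : Loop d) :
    metric A c S k = 1 / 2 * metricDeriv hA c k h h - metricDeriv hA c h h k := by
  have h1 : Continuous fun θ => inner ℝ (lengthForce A c h θ) (k θ) :=
    (contDiff_lengthForce c h).continuous.inner k.contDiff.continuous
  have h2 : Continuous fun θ => inner ℝ (opADeriv hA c h h θ) (k θ) :=
    (opADeriv hA c h h).contDiff.continuous.inner k.contDiff.continuous
  have h3 : Continuous fun θ => inner ℝ (arcDeriv c h θ) (tangent c θ) :=
    (contDiff_arcDeriv c h.contDiff).continuous.inner (contDiff_tangent c).continuous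
  have h4 : Continuous fun θ => inner ℝ (opA A c h θ) (k θ) :=
    (opA A c h).contDiff.continuous.inner k.contDiff.continuous
  have h5 := arcIntegral_add c h1 (h2.add (h3.mul h4))
  have h6 : metric A c S k = -1 * arcIntegral c (fun θ => inner ℝ (lengthForce A c h θ) (k θ)
      + (inner ℝ (opADeriv hA c h h θ) (k θ)
        + inner ℝ (arcDeriv c h θ) (tangent c θ) * inner ℝ (opA A c h θ) (k θ))) := by
    rw [← arcIntegral_const_mul, metric]
    refine congrArg (arcIntegral c) (funext fun θ => ?_)
    have h7 : opA A c S θ = -(opADeriv hA c h h θ + geodesicTerm A c h θ) := by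
      rw [hS]
      rfl
    rw [h7, geodesicTerm_eq, inner_neg_left, inner_add_left, inner_add_left, real_inner_smul_left]
    ring
  rw [metricDeriv_self hA hG hinv, integral_wTerm_mul_stretch hA hG hinv, h6]
  refine (congrArg (-1 * ·) h5).trans ?_
  change -1 * (_ + metricDeriv hA c h h k) = _
  ring

theorem arcDeriv_smul (c : Imm d) (r : ℝ) (h : Loop d) (θ : ℝ) :
    arcDeriv c (r • h : Loop d) θ = r • arcDeriv c h θ := by
  have h1 : deriv (r • h : Loop d).toFun θ = r • deriv h.toFun θ :=
    ((h.differentiable θ).hasDerivAt.const_smul r).deriv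
  rw [arcDeriv, h1, smul_comm, arcDeriv]

theorem opA'_smul (c : Imm d) (r : ℝ) (h : Loop d) (θ : ℝ) :
    opA' A c (r • h) θ = r • opA' A c h θ := by
  simp only [opA', map_smul, Loop.smul_apply]
  exact deriv_const_smul_field r _

theorem sprayTerm_smul (hA : IsSmoothOperatorFamily A) (hG : IsWeakRiemannianMetric (metric A))
    (hinv : IsReparamInvariant (metric A)) (c : Imm d) (r : ℝ) (h : Loop d) :
    sprayTerm hA hG hinv c (r • h) = r ^ 2 • sprayTerm hA hG hinv c h := by
  have hw : ∀ θ, wTerm A c (r • h) θ = r ^ 2 * wTerm A c h θ := fun θ => by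
    simp only [wTerm, map_smul, Loop.smul_apply, arcDeriv_smul, real_inner_smul_left,
      real_inner_smul_right, ← intervalIntegral.integral_const_mul]
    refine intervalIntegral.integral_congr fun σ _ => ?_
    ring
  have hw0 : wZero A c (r • h) = r ^ 2 * wZero A c h := by
    rw [wZero, wZero, ← arcIntegral_const_mul]
    refine congrArg (arcIntegral c) (funext fun θ => ?_)
    simp only [map_smul, Loop.smul_apply, arcDeriv_smul, opA'_smul, real_inner_smul_left,
      real_inner_smul_right, inner_add_left]
    ring
  rw [sprayTerm, opADeriv_smul, sprayTerm, smul_add]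
  congr 1
  refine Loop.ext fun θ => ?_
  rw [Loop.smul_apply, Loop.mk_apply, Loop.mk_apply]
  simp only [geodesicTerm, hw, hw0, map_smul, Loop.smul_apply, arcDeriv_smul, real_inner_smul_left,
    real_inner_smul_right]
  module

/-! ### The first variation of the energy -/

theorem IsSmoothFamily.slice_left {f : ℝ → ℝ → Loop d}
    (hf : IsSmoothFamily fun p : ℝ × ℝ => f p.1 p.2) (t : ℝ) : IsSmoothFamily fun ε => f ε t :=
  hf.comp (f := fun ε : ℝ => (ε, t)) (contDiff_id.prodMk contDiff_const)

theorem isSmoothFamily_velocity_left {f : ℝ → ℝ → Loop d}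
    (hf : IsSmoothFamily fun p : ℝ × ℝ => f p.1 p.2) :
    IsSmoothFamily fun p : ℝ × ℝ => velocity (fun ε => f ε p.2) (hf.slice_left p.2) p.1 :=
  (contDiff_deriv_fst (f := fun x : ℝ × ℝ × ℝ => f x.1 x.2.1 x.2.2)
    (ContDiff.comp (g := fun y : (ℝ × ℝ) × ℝ => f y.1.1 y.1.2 y.2)
      (f := fun x : ℝ × ℝ × ℝ => ((x.1, x.2.1), x.2.2)) hf (by fun_prop))).comp
    (f := fun y : (ℝ × ℝ) × ℝ => (y.1.1, (y.1.2, y.2))) (by fun_prop)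

theorem isSmoothFamily_velocity_right {f : ℝ → ℝ → Loop d}
    (hf : IsSmoothFamily fun p : ℝ × ℝ => f p.1 p.2) :
    IsSmoothFamily fun p : ℝ × ℝ => velocity (f p.1) (IsSmoothFamily.slice hf p.1) p.2 :=
  (contDiff_deriv_fst (f := fun x : ℝ × ℝ × ℝ => f x.2.1 x.1 x.2.2)
    (ContDiff.comp (g := fun y : (ℝ × ℝ) × ℝ => f y.1.1 y.1.2 y.2)
      (f := fun x : ℝ × ℝ × ℝ => ((x.2.1, x.1), x.2.2)) hf (by fun_prop))).comp
    (f := fun y : (ℝ × ℝ) × ℝ => (y.1.2, (y.1.1, y.2))) (by fun_prop)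

theorem velocity_velocity_comm {f : ℝ → ℝ → Loop d}
    (hf : IsSmoothFamily fun p : ℝ × ℝ => f p.1 p.2) (ε t : ℝ) :
    velocity (fun ε => velocity (f ε) (IsSmoothFamily.slice hf ε) t)
        ((isSmoothFamily_velocity_right hf).slice_left
          (f := fun ε t => velocity (f ε) (IsSmoothFamily.slice hf ε) t) t) ε
      = velocity (fun t => velocity (fun ε => f ε t) (hf.slice_left t) ε)
        (IsSmoothFamily.slice
          (f := fun ε t => velocity (fun ε => f ε t) (hf.slice_left t) ε)
          (isSmoothFamily_velocity_left hf) ε) t :=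
  Loop.ext fun θ => (deriv_deriv_comm (f := fun x : ℝ × ℝ => f x.1 x.2 θ)
    (ContDiff.comp (g := fun y : (ℝ × ℝ) × ℝ => f y.1.1 y.1.2 y.2)
      (f := fun x : ℝ × ℝ => (x, θ)) hf (by fun_prop)) ε t).symm

theorem metric_sub_left (c : Imm d) (h₁ h₂ k : Loop d) :
    metric A c (h₁ - h₂) k = metric A c h₁ k - metric A c h₂ k := by
  rw [eq_sub_iff_add_eq, ← metric_add_left, sub_add_cancel]

theorem metric_smul_right (c : Imm d) (r : ℝ) (h k : Loop d) :
    metric A c h (r • k) = r * metric A c h k := by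
  simp only [metric, ← arcIntegral_const_mul, Loop.smul_apply, real_inner_smul_right]

variable {S : Imm d → Loop d → Loop d}

/-- The first variation of the energy: the variation is by the field `m`. -/
theorem hasDerivAt_energy (hA : IsSmoothOperatorFamily A)
    (hG : IsWeakRiemannianMetric (metric A))
    (hS : ∀ c h k, metric A c (S c h) k
      = 1 / 2 * metricDeriv hA c k h h - metricDeriv hA c h h k)
    {f : ℝ → ℝ → Imm d} (hf : IsSmoothFamily fun p : ℝ × ℝ => (f p.1 p.2).loop)
    {c : ℝ → Imm d} (hc : IsSmoothFamily fun t => (c t).loop) (hfc : ∀ t, f 0 t = c t)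
    {m : ℝ → Loop d}
    (hm : ∀ t θ, HasDerivAt (fun ε => (f ε t).loop θ) (m t θ) 0) :
    (Continuous fun t => metric A (c t)
      (S (c t) (pathVelocity c hc t) - pathAcceleration c hc t) (m t)) ∧
    (m 0 = 0 → m 1 = 0 →
      HasDerivAt (fun ε => energy (metric A) (f ε)
          (IsSmoothFamily.slice (f := fun ε t => (f ε t).loop) hf ε))
        (∫ t in (0 : ℝ)..1, metric A (c t)
          (S (c t) (pathVelocity c hc t) - pathAcceleration c hc t) (m t)) 0) := by
  obtain rfl : f 0 = c := funext hfc
  let u : ℝ → ℝ → Loop d := fun ε t => (f ε t).loop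
  have hu : IsSmoothFamily fun p : ℝ × ℝ => u p.1 p.2 := hf
  let h : ℝ → ℝ → Loop d := fun ε t => velocity (u ε) (IsSmoothFamily.slice hu ε) t
  have hh : IsSmoothFamily fun p : ℝ × ℝ => h p.1 p.2 := isSmoothFamily_velocity_right hu
  obtain rfl : (fun t => velocity (fun ε => u ε t) (hu.slice_left t) 0) = m :=
    funext fun t => velocity_eq_of_hasDerivAt _ (hm t)
  set m : ℝ → Loop d := fun t => velocity (fun ε => u ε t) (hu.slice_left t) 0
  have hms : IsSmoothFamily m :=
    IsSmoothFamily.slice (f := fun ε t => velocity (fun ε => u ε t) (hu.slice_left t) ε)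
      (isSmoothFamily_velocity_left hu) 0
  let g : ℝ × ℝ → ℝ := fun p => metric A (f p.1 p.2) (h p.1 p.2) (h p.1 p.2)
  have hg : ContDiff ℝ ∞ g := contDiff_metric hA hf hh hh
  -- The boundary term of the integration by parts in `t`; it vanishes at both ends when `m` does.
  let b : ℝ → ℝ := fun t => metric A (f 0 t) (h 0 t) (m t)
  have hb : ContDiff ℝ ∞ b := contDiff_metric hA hc (IsSmoothFamily.slice hh 0) hms
  have h1 : ∀ t, HasDerivAt (fun ε => g (ε, t)) (metricDeriv hA (f 0 t) (m t) (h 0 t) (h 0 t)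
      + 2 * metric A (f 0 t) (h 0 t) (velocity m hms t)) 0 := by
    intro t
    have h2 := hasDerivAt_metric hA (c := fun ε => f ε t) (hu.slice_left t)
      (hh.slice_left t) (hh.slice_left t) 0
    have h3 : velocity (fun ε => h ε t) (hh.slice_left t) 0 = velocity m hms t :=
      velocity_velocity_comm hu 0 t
    rw [h3, hG.symm _ (velocity m hms t), add_assoc, ← two_mul] at h2
    exact h2
  have h4 : ∀ t, HasDerivAt b (metricDeriv hA (f 0 t) (h 0 t) (h 0 t) (m t)
      + metric A (f 0 t) (pathAcceleration (f 0) hc t) (m t)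
      + metric A (f 0 t) (h 0 t) (velocity m hms t)) t := fun t =>
    hasDerivAt_metric hA hc (IsSmoothFamily.slice hh 0) hms t
  -- The pairing of `c_t` with `∂_t m` occurs in both `½ ∂_ε g` and `b'` and cancels, leaving the
  -- spray identity `hS`. The right side is continuous in `t`, so no regularity of `S` in `c` is
  -- required.
  have h5 : ∀ t, metric A (f 0 t)
      (S (f 0 t) (pathVelocity (f 0) hc t) - pathAcceleration (f 0) hc t) (m t)
      = 1 / 2 * deriv (fun ε => g (ε, t)) 0 - deriv b t := by
    intro t
    have h6 : pathVelocity (f 0) hc t = h 0 t := rfl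
    rw [metric_sub_left, hS, (h1 t).deriv, (h4 t).deriv, h6]
    ring
  have h7 : Continuous fun t => deriv (fun ε => g (ε, t)) 0 :=
    (contDiff_deriv_fst hg).continuous.comp (f := fun t : ℝ => ((0 : ℝ), t)) (by fun_prop)
  have h8 : Continuous (deriv b) := (contDiff_infty_iff_deriv.1 hb).2.continuous
  simp only [h5]
  refine ⟨(continuous_const.mul h7).sub h8, fun hm0 hm1 => ?_⟩
  have h9 : (∫ t in (0 : ℝ)..1, deriv b t) = 0 := by
    rw [intervalIntegral.integral_deriv_eq_sub
      (fun t _ => (h4 t).differentiableAt) (h8.intervalIntegrable _ _)]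
    simp only [b, hm0, hm1, metric_zero_right, sub_self]
  rw [intervalIntegral.integral_sub ((h7.const_mul (1 / 2)).intervalIntegrable _ _)
    (h8.intervalIntegrable _ _), h9, sub_zero, intervalIntegral.integral_const_mul]
  exact (hasDerivAt_intervalIntegral hg 0 1 0).const_mul (1 / 2)

/-- A path can be varied by a bump function times a loop. -/
theorem exists_bump_variation {c : ℝ → Imm d} (hc : IsSmoothFamily fun t => (c t).loop)
    {t₀ : ℝ} (β : ContDiffBump t₀) (k : Loop d) :
    ∃ f : ℝ → ℝ → Imm d, IsSmoothFamily (fun p : ℝ × ℝ => (f p.1 p.2).loop) ∧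
      (∀ t, f 0 t = c t) ∧ (∀ ε, ∀ t ∉ Metric.ball t₀ β.rOut, f ε t = c t) ∧
      ∀ t θ, HasDerivAt (fun ε => (f ε t).loop θ) ((β t • k) θ) 0 := by
  have hm : IsSmoothFamily fun t => β t • k :=
    ContDiff.smul (β.contDiff.comp contDiff_fst) (k.contDiff.comp contDiff_snd)
  have hβ : ∀ t ∉ Metric.ball t₀ β.rOut, β t • k = 0 := fun t ht => by
    rw [← β.support_eq, Function.notMem_support] at ht
    rw [ht, zero_smul]
  obtain ⟨χ, f, hχ, hχ0, hχ1, hf⟩ := exists_variation hc hm (isCompact_closedBall t₀ β.rOut)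
    fun t ht => hβ t fun h => ht (Metric.ball_subset_closedBall h)
  refine ⟨f, ?_, fun t => Imm.ext_loop ?_, fun ε t ht => Imm.ext_loop ?_, fun t θ => ?_⟩
  · simp only [hf]
    exact isSmoothFamily_variation hc hm hχ
  · rw [hf, hχ0, zero_smul, add_zero]
  · rw [hf, hβ t ht, smul_zero, add_zero]
  · simp only [hf]
    exact hasDerivAt_variation _ _ hχ1 θ

theorem velocity_congr {γ₁ γ₂ : ℝ → Loop d} (h₁ : IsSmoothFamily γ₁) (h₂ : IsSmoothFamily γ₂)
    {t : ℝ} (h : γ₁ =ᶠ[𝓝 t] γ₂) : velocity γ₁ h₁ t = velocity γ₂ h₂ t :=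
  velocity_eq_of_hasDerivAt h₁ fun θ => (hasDerivAt_velocity h₂ t θ).congr_of_eventuallyEq
    (h.fun_comp (fun l : Loop d => l θ))

/-- Geodesics are the solutions of the spray equation. -/
theorem isGeodesic_iff (hA : IsSmoothOperatorFamily A) (hG : IsWeakRiemannianMetric (metric A))
    (hS : ∀ c h k, metric A c (S c h) k
      = 1 / 2 * metricDeriv hA c k h h - metricDeriv hA c h h k)
    {c : ℝ → Imm d} (hc : IsSmoothFamily fun t => (c t).loop) :
    IsGeodesic (metric A) c ↔
      ∀ t ∈ Set.Icc (0 : ℝ) 1, pathAcceleration c hc t = S (c t) (pathVelocity c hc t) := by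
  constructor
  · intro hgeo
    let D : Loop d → ℝ → ℝ := fun k t => metric A (c t)
      (S (c t) (pathVelocity c hc t) - pathAcceleration c hc t) k
    have hDβ : ∀ (t₀ : ℝ) (β : ContDiffBump t₀) (k : Loop d) (t : ℝ),
        metric A (c t) (S (c t) (pathVelocity c hc t) - pathAcceleration c hc t) (β t • k)
          = β t * D k t := fun t₀ β k t => metric_smul_right _ _ _ _
    have hDc : ∀ k, Continuous (D k) := by
      intro k
      rw [continuous_iff_continuousAt]
      intro t₀
      -- A bump equal to `1` near `t₀` exhibits `D k` locally as the continuous integrand of a first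
      -- variation.
      let β : ContDiffBump t₀ := ⟨1, 2, one_pos, one_lt_two⟩
      obtain ⟨f, hf, hf0, -, hfm⟩ := exists_bump_variation hc β k
      have h1 := (hasDerivAt_energy hA hG hS hf hc hf0 hfm).1
      refine h1.continuousAt.congr ?_
      filter_upwards [β.eventuallyEq_one] with t ht
      rw [hDβ, ht, Pi.one_apply, one_mul]
    -- The inequality suffices: the loop `k` will be taken to be the defect itself, where positivity
    -- of `G` applies.
    have hD0 : ∀ k, ∀ t₀ ∈ Set.Ioo (0 : ℝ) 1, D k t₀ ≤ 0 := by
      intro k t₀ ht₀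
      by_contra! hpos
      obtain ⟨r, hr, hr'⟩ := Metric.mem_nhds_iff.1 (Filter.inter_mem
        ((isOpen_lt continuous_const (hDc k)).mem_nhds hpos) (isOpen_Ioo.mem_nhds ht₀))
      -- The support lies in `(0, 1)` and in the region where `D k` is positive, so the variation
      -- fixes the endpoints and the first variation would be strictly positive.
      let β : ContDiffBump t₀ := ⟨r / 2, r, half_pos hr, half_lt_self hr⟩
      obtain ⟨f, hf, hf0, hfc, hfm⟩ := exists_bump_variation hc β k
      have hout : ∀ t, t ∉ Set.Ioo (0 : ℝ) 1 → t ∉ Metric.ball t₀ r := fun t ht h =>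
        ht (hr' h).2
      have hβ0 : ∀ t, t ∉ Metric.ball t₀ r → β t = 0 := fun t ht => by
        have h2 : Function.support β = Metric.ball t₀ r := β.support_eq
        rwa [← h2, Function.notMem_support] at ht
      have h0 : (0 : ℝ) ∉ Set.Ioo (0 : ℝ) 1 := fun h => lt_irrefl _ h.1
      have h1 : (1 : ℝ) ∉ Set.Ioo (0 : ℝ) 1 := fun h => lt_irrefl _ h.2
      obtain ⟨h3, h4⟩ := hasDerivAt_energy hA hG hS hf hc hf0 hfm
      have h5 := h4 (by rw [hβ0 0 (hout 0 h0), zero_smul]) (by rw [hβ0 1 (hout 1 h1), zero_smul])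
      have h6 := h5.unique (hgeo f hf (fun t _ => hf0 t) (fun ε => hfc ε 0 (hout 0 h0))
        (fun ε => hfc ε 1 (hout 1 h1)))
      simp only [hDβ] at h3 h6
      have h7 : 0 < ∫ t in (0 : ℝ)..1, β t * D k t := by
        refine intervalIntegral.integral_pos one_pos h3.continuousOn (fun t _ => ?_)
          ⟨t₀, ⟨ht₀.1.le, ht₀.2.le⟩, mul_pos (β.pos_of_mem_ball (Metric.mem_ball_self hr)) hpos⟩
        by_cases ht : t ∈ Metric.ball t₀ r
        · exact mul_nonneg β.nonneg (le_of_lt (hr' ht).1)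
        · rw [hβ0 t ht, zero_mul]
      exact h7.ne' h6
    intro t ht
    have h1 : D (S (c t) (pathVelocity c hc t) - pathAcceleration c hc t) t ≤ 0 := by
      -- Continuity of `D k` extends the inequality to the endpoints `0` and `1`.
      have h2 : closure (Set.Ioo (0 : ℝ) 1) ⊆ {t' | D (S (c t) (pathVelocity c hc t)
          - pathAcceleration c hc t) t' ≤ 0} :=
        closure_minimal (fun t' => hD0 _ t') (isClosed_le (hDc _) continuous_const)
      rw [closure_Ioo zero_ne_one] at h2
      exact h2 ht
    by_contra hne
    exact (hG.pos (c t) _ (sub_ne_zero.2 (Ne.symm hne))).not_ge h1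
  · intro hspray f hf hf0 hfε0 hfε1
    have hf0s : IsSmoothFamily fun t => (f 0 t).loop :=
      IsSmoothFamily.slice (f := fun ε t => (f ε t).loop) hf 0
    have hu : ∀ t, IsSmoothFamily fun ε => (f ε t).loop :=
      IsSmoothFamily.slice_left (f := fun ε t => (f ε t).loop) hf
    have h1 := (hasDerivAt_energy hA hG hS hf hf0s (fun _ => rfl)
      (m := fun t => velocity _ (hu t) 0) (fun t θ => hasDerivAt_velocity (hu t) 0 θ)).2
      (velocity_eq_of_hasDerivAt _ fun θ => by
        simp only [hfε0]
        exact hasDerivAt_const 0 _)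
      (velocity_eq_of_hasDerivAt _ fun θ => by
        simp only [hfε1]
        exact hasDerivAt_const 0 _)
    refine h1.congr_deriv (intervalIntegral.integral_zero_ae ?_)
    -- `f 0` and `c` agree only on `[0, 1]`, so their time derivatives are compared on the open
    -- interval; discarding the null point `1` leaves exactly that.
    filter_upwards [(Set.finite_singleton (1 : ℝ)).countable.ae_notMem _] with t ht1 ht
    rw [Set.uIoc_of_le zero_le_one] at ht
    have ht' : t ∈ Set.Ioo (0 : ℝ) 1 := ⟨ht.1, lt_of_le_of_ne ht.2 ht1⟩
    have hev : ∀ t ∈ Set.Ioo (0 : ℝ) 1, (fun t => (f 0 t).loop) =ᶠ[𝓝 t] fun t => (c t).loop := by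
      intro t ht
      filter_upwards [isOpen_Ioo.mem_nhds ht] with s hs
      rw [hf0 s (Set.Ioo_subset_Icc_self hs)]
    have h2 : ∀ t ∈ Set.Ioo (0 : ℝ) 1, pathVelocity (f 0) hf0s t = pathVelocity c hc t :=
      fun t ht => velocity_congr _ _ (hev t ht)
    have h3 : pathAcceleration (f 0) hf0s t = pathAcceleration c hc t := by
      refine velocity_congr _ _ ?_
      filter_upwards [isOpen_Ioo.mem_nhds ht'] with s hs using h2 s hs
    rw [h2 t ht', h3, hf0 t (Set.Ioo_subset_Icc_self ht'),
      hspray t (Set.Ioo_subset_Icc_self ht'), sub_self, metric_zero_left]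

end ImmersedCurves

end

/-! ### The spray and the two forms of the geodesic equation. -/

theorem mainTheorem6 (d : ℕ) (A : ℝ → Loop d →L[ℝ] Loop d)
    (hA_smooth : IsSmoothOperatorFamily A)
    (hG_riem : IsWeakRiemannianMetric (metric A))
    (hG_inv : IsReparamInvariant (metric A))
    (hA_inv : ∀ l : ℝ, 0 < l → (A l).IsInvertible) :
    (∀ c : Imm d, Function.Bijective (opA A c)) ∧
    ∃ (DA : Imm d → Loop d → Loop d → Loop d) (S : Imm d → Loop d → Loop d),
      -- `DA c h k = (D_{c,h} A_c) k`
      (∀ c h k, HasDirDeriv (fun c' => opA A c' k) c h (DA c h k)) ∧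
      -- the formula for `S_c(h)`
      (∀ c h θ, opA A c (S c h) θ = -(DA c h h θ + geodesicTerm A c h θ)) ∧
      -- the geodesic spray
      IsGeodesicSpray (metric A) (fun x => (x.2, S x.1 x.2)) ∧
      -- geodesics are the solutions of the spray equation and of the geodesic equation
      ∀ (c : ℝ → Imm d) (hc : IsSmoothFamily (fun t => (c t).loop)),
        (IsGeodesic (metric A) c ↔
          ∀ t ∈ Set.Icc (0 : ℝ) 1, pathAcceleration c hc t = S (c t) (pathVelocity c hc t)) ∧
        (IsGeodesic (metric A) c ↔
          ∀ t ∈ Set.Icc (0 : ℝ) 1, ∀ θ : ℝ,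
            HasDerivAt (fun τ => opA A (c τ) (pathVelocity c hc τ) θ)
              (-(inner ℝ (arcDeriv (c t) (pathVelocity c hc t) θ) (tangent (c t) θ)
                  • opA A (c t) (pathVelocity c hc t) θ)
                - inner ℝ (opA A (c t) (pathVelocity c hc t) θ)
                    (arcDeriv (c t) (pathVelocity c hc t) θ) • tangent (c t) θ
                - (wTerm A (c t) (pathVelocity c hc t) θ + wZero A (c t) (pathVelocity c hc t))
                    • arcDeriv (c t) (tangent (c t)) θ) t) := by
  have hS : ∀ c h, ∃ s, opA A c s = -sprayTerm hA_smooth hG_riem hG_inv c h := fun c h =>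
    (bijective_opA hA_inv c).2 _
  choose S hS using hS
  have hmetric : ∀ c h k, metric A c (S c h) k
      = 1 / 2 * metricDeriv hA_smooth c k h h - metricDeriv hA_smooth c h h k := fun c h k =>
    metric_eq_of_opA_eq_neg_sprayTerm hA_smooth hG_riem hG_inv (hS c h) k
  refine ⟨bijective_opA hA_inv, opADeriv hA_smooth, S, hasDirDeriv_opA hA_smooth, ?_, ?_, ?_⟩
  · intro c h θ
    rw [hS]
    rfl
  · refine ⟨fun _ _ => rfl, fun c h r => (bijective_opA hA_inv c).1 ?_, fun c h k =>
      ⟨_, _, hasDirDeriv_metric hA_smooth c k h h, hasDirDeriv_metric hA_smooth c h h k,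
        hmetric c h k⟩⟩
    -- Homogeneity is checked after applying the injective `A_c`, where it becomes that of
    -- `sprayTerm`.
    change opA A c (S c (r • h)) = opA A c (r ^ 2 • S c h)
    rw [hS, map_smul, hS, sprayTerm_smul, smul_neg]
  · intro c hc
    have h1 := isGeodesic_iff hA_smooth hG_riem hmetric hc
    refine ⟨h1, h1.trans (forall₂_congr fun t _ => ?_)⟩
    -- By this product rule the geodesic equation is the spray equation with `A_c` applied to both
    -- sides; injectivity of `A_c` gives the converse.
    have h2 := hasDerivAt_opA hA_smooth hc (isSmoothFamily_velocity _ hc) t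
    have h3 : ∀ θ, opA A (c t) (S (c t) (pathVelocity c hc t)) θ
        = -(opADeriv hA_smooth (c t) (pathVelocity c hc t) (pathVelocity c hc t) θ
          + geodesicTerm A (c t) (pathVelocity c hc t) θ) := fun θ => by
      rw [hS]
      rfl
    constructor
    · intro h4 θ
      refine (h2 θ).congr_deriv ?_
      change opADeriv hA_smooth (c t) (pathVelocity c hc t) (pathVelocity c hc t) θ
        + opA A (c t) (pathAcceleration c hc t) θ = _
      rw [h4, h3, geodesicTerm]
      abel
    · intro h4
      refine (bijective_opA hA_inv (c t)).1 (Loop.ext fun θ => ?_)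
      have h5 : opADeriv hA_smooth (c t) (pathVelocity c hc t) (pathVelocity c hc t) θ
        + opA A (c t) (pathAcceleration c hc t) θ = _ := (h2 θ).unique (h4 θ)
      rw [h3, geodesicTerm, eq_sub_of_add_eq' h5]
      abel
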